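/- Let $\Omega\subset\mathbb R^n$ be open and let $f\in C^2(\Omega;\mathbb R^n)$ be such that $u_t+f(u)_x=0$ is strictly hyperbolic: $Df(u)$ has real eigenvalues $\lambda_1(u)<\dots<\lambda_n(u)$ for every $u\in\Omega$, with $C^1$ eigenvector fields $r_1,\dots,r_n$ on $\Omega$; let $(\ell_1(u),\dots,\ell_n(u))$ be the dual basis of $(r_1(u),\dots,r_n(u))$. Fix $i$ and assume that the $i$-th characteristic field is monotone: $r_i\cdot\nabla\lambda_i\ge 0$ in $\Omega$. All $i$-curves $\Gamma$ issued from a state $u_0$ are parameterized by $s=\ell_i(u_0)\cdot(\Gamma(s)-u_0)$. * The *$i$-th rarefaction curve* $\mathcal R_i(\cdot;u_0)$ is the integral curve through $u_0$ of the direction field spanned by $r_i$. * The *$i$-th Hugoniot curve* $\mathcal S_i(\cdot;u_0)$ is a continuous curve with $\mathcal S_i(0;u_0)=u_0$ for which there is a continuous speed $\sigma$ with $\sigma(0)=\lambda_i(u_0)$ and $f(\mathcal S_i(s;u_0))-f(u_0)=\sigma(s)\,(\mathcal S_i(s;u_0)-u_0)$. * An *elementary $i$-wave* with left state $u_l$ and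 right state $u_r$ is one of the following. (a) A rarefaction: $u_r=\mathcal R_i(s;u_l)$ and $\lambda_i$ is non-decreasing along this curve from $u_l$ to $u_r$; its speeds range from $\lambda_i(u_l)$ to $\lambda_i(u_r)$, and arcs on which $\lambda_i$ is constant are contact discontinuities. (b) A contact discontinuity: the same, with $\lambda_i$ constant, equal to the speed of the wave. (c) An admissible shock: $u_r=\mathcal S_i(s;u_l)$ with speed $\sigma(s)$, satisfying Liu's E-condition $\sigma(s)\le\sigma(\tau)$ for all $\tau$ between $0$ and $s$. * The *Lax $i$-th wave curve* of $u_0$ in an open set $U$ is the set of all right states that can be connected to the left state $u_0$ by a finite (possibly empty) succession of elementary $i$-waves whose curves lie in $U$, each wave travelling at least as fast as the preceding one. Then for every $\bar u\in\Omega$ there are an open set $U$ with $\bar u\in U\subset\Omega$, a neighborhood $W$ of $\bar u$ and $s_0>0$ such that, for every $u_0\in W$, curves $\mathcal R_i(\cdot;u_0)$ and $\mathcal S_i(\cdot;u_0)$ exist on $[-s_0,s_0]$ with values in $U$, and, for any such curves on $[-s_0,s_0]$ (with values in $\Omega$), the part of the Lax $i$-th wave curve of $u_0$ in $U$ consisting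 of the $u$ with $|\ell_i(u_0)\cdot(u-u_0)|\le s_0$ is exactly the curve $$\mathcal T_i(s;u_0)=\begin{cases}\mathcal R_i(s;u_0)&\text{if } s\ge 0,\\ \mathcal S_i(s;u_0)&\text{if } s\le 0,\end{cases}\qquad s\in[-s_0,s_0].$$ Moreover, for $0\le s\le s_0$ the states $u_0$ and $\mathcal R_i(s;u_0)$ are connected by a single rarefaction in the sense of (a) inside $U$, and for $-s_0\le s\le 0$ the states $u_0$ and $\mathcal S_i(s;u_0)$ are connected by a single shock of speed $\sigma(s)$ inside $U$ satisfying Liu's E-condition. -/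

import Mathlib

open Set Filter Topology

noncomputable section

namespace ConservationLaw

/-- State space `ℝⁿ`. Only its topology and linear structure are used below. -/
abbrev State (n : ℕ) : Type := Fin n → ℝ

/-- The system `u_t + f(u)_x = 0`, with flux `f` of class `C²` on the open set `Ω ⊆ ℝⁿ`, is strictly
hyperbolic: at each `u ∈ Ω` the Jacobian `Df(u)` has the `n` real eigenvalues
`lam 0 u < lam 1 u < ... < lam (n-1) u`, and `r j` is a `C¹` field of eigenvectors for `lam j`. -/
structure IsStrictlyHyperbolic {n : ℕ} (f : State n → State n) (Ω : Set (State n))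
    (lam : Fin n → State n → ℝ) (r : Fin n → State n → State n) : Prop where
  isOpen : IsOpen Ω
  contDiffOn_flux : ContDiffOn ℝ 2 f Ω
  strictMono : ∀ u ∈ Ω, StrictMono (fun j => lam j u)
  eigen : ∀ u ∈ Ω, ∀ j, fderiv ℝ f u (r j u) = lam j u • r j u
  ne_zero : ∀ u ∈ Ω, ∀ j, r j u ≠ 0
  contDiffOn_eigenvector : ∀ j, ContDiffOn ℝ 1 (r j) Ω

/-- The `i`-th characteristic field is monotone: `r_i · ∇λ_i ≥ 0` in `Ω`. -/
def IsMonotoneField {n : ℕ} (Ω : Set (State n)) (lam : Fin n → State n → ℝ)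
    (r : Fin n → State n → State n) (i : Fin n) : Prop :=
  ∀ u ∈ Ω, 0 ≤ fderiv ℝ (lam i) u (r i u)

/-- `dualCovector r i u v` is `ℓ_i(u) · v`, where `(ℓ_1(u), ..., ℓ_n(u))` is the dual basis of
`(r_1(u), ..., r_n(u))`: the rows of the inverse of the matrix with columns `r_j(u)`. -/
def dualCovector {n : ℕ} (r : Fin n → State n → State n) (i : Fin n) (u v : State n) : ℝ :=
  Matrix.mulVec (Matrix.of fun a j => r j u a)⁻¹ v i

/-- `γ` is, on the interval `I ∋ 0`, the `i`-th rarefaction curve starting from `u₀`: it is an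
integral curve, contained in `U`, of the direction field spanned by `r_i`, parameterized by
`s = ℓ_i(u₀) · (γ(s) - u₀)` (which forces its derivative not to vanish). -/
structure IsRarefactionCurve {n : ℕ} (r : Fin n → State n → State n) (i : Fin n)
    (U : Set (State n)) (u₀ : State n) (I : Set ℝ) (γ : ℝ → State n) : Prop where
  start : γ 0 = u₀
  mem : ∀ s ∈ I, γ s ∈ U
  tangent : ∀ s ∈ I, ∃ c : ℝ, HasDerivWithinAt γ (c • r i (γ s)) I s
  param : ∀ s ∈ I, dualCovector r i u₀ (γ s - u₀) = s

/-- `H` is, on the interval `I ∋ 0`, the `i`-th branch of the Hugoniot locus of `u₀`, and `σ` is the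
associated shock speed: a continuous curve of solutions, contained in `U`, of the
Rankine-Hugoniot relation `f(H) - f(u₀) = σ (H - u₀)`, issued from `u₀` with speed `λ_i(u₀)`,
parameterized by `s = ℓ_i(u₀) · (H(s) - u₀)`. -/
structure IsHugoniotCurve {n : ℕ} (f : State n → State n) (lam : Fin n → State n → ℝ)
    (r : Fin n → State n → State n) (i : Fin n) (U : Set (State n)) (u₀ : State n)
    (I : Set ℝ) (H : ℝ → State n) (σ : ℝ → ℝ) : Prop where
  start : H 0 = u₀
  speed_start : σ 0 = lam i u₀
  continuousOn : ContinuousOn H I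
  continuousOn_speed : ContinuousOn σ I
  mem : ∀ s ∈ I, H s ∈ U
  rankineHugoniot : ∀ s ∈ I, f (H s) - f u₀ = σ s • (H s - u₀)
  param : ∀ s ∈ I, dualCovector r i u₀ (H s - u₀) = s

/-- The left state `uₗ` is connected to the right state `uᵣ` by an `i`-rarefaction inside `U`, whose
speeds range from `a = λ_i(uₗ)` to `b = λ_i(uᵣ)`: `λ_i` is non-decreasing along the portion of the
`i`-th rarefaction curve going from `uₗ` to `uᵣ` (in either direction of the curve). On
sub-arcs where `λ_i` is constant, the wave is a contact discontinuity; there may be infinitely many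
such sub-arcs. -/
def IsRarefactionWave {n : ℕ} (lam : Fin n → State n → ℝ) (r : Fin n → State n → State n)
    (i : Fin n) (U : Set (State n)) (uₗ uᵣ : State n) (a b : ℝ) : Prop :=
  ∃ (s : ℝ) (γ : ℝ → State n), IsRarefactionCurve r i U uₗ (uIcc 0 s) γ ∧ γ s = uᵣ ∧
    (∀ τ₁ ∈ uIcc 0 s, ∀ τ₂ ∈ uIcc 0 s, |τ₁| ≤ |τ₂| → lam i (γ τ₁) ≤ lam i (γ τ₂)) ∧
    a = lam i uₗ ∧ b = lam i uᵣ

/-- The left state `uₗ` is connected to the right state `uᵣ` by an `i`-contact discontinuity of speed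
`σ` inside `U`: `λ_i` is constant, equal to `σ`, along the portion of the `i`-th rarefaction curve
joining them. -/
def IsContactDiscontinuity {n : ℕ} (lam : Fin n → State n → ℝ) (r : Fin n → State n → State n)
    (i : Fin n) (U : Set (State n)) (uₗ uᵣ : State n) (σ : ℝ) : Prop :=
  ∃ (s : ℝ) (γ : ℝ → State n), IsRarefactionCurve r i U uₗ (uIcc 0 s) γ ∧ γ s = uᵣ ∧
    ∀ τ ∈ uIcc 0 s, lam i (γ τ) = σ

/-- The left state `uₗ` is connected to the right state `uᵣ` by an `i`-shock of speed `σ` inside `U`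
satisfying Liu's E-condition: `uᵣ` lies on the `i`-th Hugoniot curve of `uₗ`, and the speed
of the shock does not exceed the speed of any intermediate shock `(uₗ, H τ)`. -/
def IsAdmissibleShock {n : ℕ} (f : State n → State n) (lam : Fin n → State n → ℝ)
    (r : Fin n → State n → State n) (i : Fin n) (U : Set (State n)) (uₗ uᵣ : State n)
    (σ : ℝ) : Prop :=
  ∃ (s : ℝ) (H : ℝ → State n) (v : ℝ → ℝ), IsHugoniotCurve f lam r i U uₗ (uIcc 0 s) H v ∧
    H s = uᵣ ∧ v s = σ ∧ ∀ τ ∈ uIcc 0 s, v s ≤ v τ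

/-- Elementary waves of the `i`-th family inside `U` with left state `uₗ`, right state `uᵣ`, whose
speeds range from `a` (left edge) to `b` (right edge). -/
inductive IsElementaryWave {n : ℕ} (f : State n → State n) (lam : Fin n → State n → ℝ)
    (r : Fin n → State n → State n) (i : Fin n) (U : Set (State n)) :
    State n → State n → ℝ → ℝ → Prop
  | rarefaction {uₗ uᵣ : State n} {a b : ℝ} :
      IsRarefactionWave lam r i U uₗ uᵣ a b → IsElementaryWave f lam r i U uₗ uᵣ a b
  | contact {uₗ uᵣ : State n} {σ : ℝ} :
      IsContactDiscontinuity lam r i U uₗ uᵣ σ → IsElementaryWave f lam r i U uₗ uᵣ σ σ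
  | shock {uₗ uᵣ : State n} {σ : ℝ} :
      IsAdmissibleShock f lam r i U uₗ uᵣ σ → IsElementaryWave f lam r i U uₗ uᵣ σ σ

/-- `IsWaveFan f lam r i U uₗ uᵣ b`: inside `U`, the state `uₗ` is connected to the state `uᵣ` on its
right by a finite nonempty succession of elementary waves of the `i`-th family, each
travelling at least as fast as the preceding one, the right edge of the last one having speed `b`. -/
inductive IsWaveFan {n : ℕ} (f : State n → State n) (lam : Fin n → State n → ℝ)
    (r : Fin n → State n → State n) (i : Fin n) (U : Set (State n)) (uₗ : State n) :
    State n → ℝ → Prop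
  | single {u : State n} {a b : ℝ} :
      IsElementaryWave f lam r i U uₗ u a b → IsWaveFan f lam r i U uₗ u b
  | append {u w : State n} {b a' b' : ℝ} :
      IsWaveFan f lam r i U uₗ u b → IsElementaryWave f lam r i U u w a' b' → b ≤ a' →
        IsWaveFan f lam r i U uₗ w b'

/-- The `i`-th Lax wave curve of `u₀` inside `U`, as a set: all right states that can be connected to
the left state `u₀` by a succession of elementary waves of the `i`-th family inside `U`. -/
def laxWaveSet {n : ℕ} (f : State n → State n) (lam : Fin n → State n → ℝ)
    (r : Fin n → State n → State n) (i : Fin n) (U : Set (State n)) (u₀ : State n) :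
    Set (State n) :=
  {u | u = u₀ ∨ ∃ b : ℝ, IsWaveFan f lam r i U u₀ u b}

/-- The curve that equals `R` for `s ≥ 0` and `S` for `s ≤ 0` (the two agree at `s = 0`). -/
def gluedCurve {n : ℕ} (R S : ℝ → State n) (s : ℝ) : State n := if 0 ≤ s then R s else S s

end ConservationLaw

end

/-!
Near `ubar` all data of the `i`-th field are close to their values at `ubar`, uniformly; this is
recorded by `IsControlBall`, with one constant `Q` and a radius `ρ` small compared with `Q⁻⁵`.

**Hugoniot curves.** With `H(s) = u₀ + s w(s)`, the Rankine-Hugoniot relation divided by `s` is a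
perturbation, uniform in `u₀` and `s`, of the eigenvalue problem `Df(ubar) w = σ w`,
`ℓ_i(ubar) w = 1`, whose linearization is invertible because `λ_i` is simple. This gives existence
(`exists_hugoniotCurve`) and, with an a priori bound on the speed, uniqueness
(`hugoniotCurve_unique`). Differentiating the relation at `s ≠ 0` shows that the gap
`φ = λ_i(H) - σ` satisfies `σ' = a φ / s` with `a ∈ [1/2, 2]`, and that `H'` is along `r_i(H)` up to
`O(|φ|)`; monotonicity of the field then yields `φ' ≥ -C |φ| - a φ / s`. This singular inequality
(`nonneg_of_singular_ineq`) forces `φ` to have the sign of `s`, so that `σ` is nondecreasing, and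
makes any zero of `φ` propagate back to `s = 0`. Hence Liu's condition holds on the branch
`s ≤ 0`, and a Hugoniot arc which is sonic at its end, or whose speed returns to `λ_i(u₀)`, consists
of characteristic states and is an arc of integral curve of `r_i`, i.e. a contact discontinuity.

**Collapse of wave fans.** It follows that every elementary wave is either a forward arc of integral
curve (a rarefaction) or a backward shock, the latter satisfying the Lax inequalities
`λ_i(u_r) ≤ σ ≤ λ_i(u_l)`. When the speeds of successive waves are nondecreasing, these inequalities
become equalities as soon as a shock meets another wave, so the shock is a contact discontinuity and
both waves lie on one integral curve. By induction a whole fan is a single forward arc or a single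
backward shock (`isForwardArc_or_isBackwardShock_of_isWaveFan`), and uniqueness of rarefaction and
Hugoniot curves identifies its end state as a point of the glued curve. Integral curves are
compared through a globally Lipschitz extension of the direction field (`directionField`).
-/

noncomputable section

/-! ### The dual basis and the regularity of the eigenvalues -/

namespace ConservationLaw

/-- The covector `ℓ_i(u)` of the dual basis of `(r_1(u), ..., r_n(u))`, as a continuous linear form:
the `i`-th row of the inverse of the matrix whose columns are the `r_j(u)`. -/
def leftForm {n : ℕ} (r : Fin n → State n → State n) (i : Fin n) (u : State n) :
    State n →L[ℝ] ℝ :=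
  ∑ a, ((Matrix.of fun a j => r j u a)⁻¹ i a) • ContinuousLinearMap.proj (R := ℝ) a

variable {n : ℕ} {f : State n → State n} {Ω : Set (State n)} {lam : Fin n → State n → ℝ}
  {r : Fin n → State n → State n} {i : Fin n} {u v : State n}

theorem leftForm_apply : leftForm r i u v = dualCovector r i u v := by
  simp [leftForm, dualCovector, Matrix.mulVec, dotProduct]

namespace IsStrictlyHyperbolic

variable (h : IsStrictlyHyperbolic f Ω lam r)
include h

theorem linearIndependent (hu : u ∈ Ω) : LinearIndependent ℝ (fun j => r j u) := by
  refine Module.End.eigenvectors_linearIndependent' (fderiv ℝ f u : State n →ₗ[ℝ] State n)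
    (fun j => lam j u) (h.strictMono u hu).injective _ fun j => ?_
  rw [Module.End.hasEigenvector_iff, Module.End.mem_eigenspace_iff]
  exact ⟨h.eigen u hu j, h.ne_zero u hu j⟩

theorem isUnit_matrix (hu : u ∈ Ω) : IsUnit (Matrix.of fun a j => r j u a) :=
  Matrix.linearIndependent_cols_iff_isUnit.1 (h.linearIndependent hu)

theorem leftForm_eigenvector (hu : u ∈ Ω) (j : Fin n) :
    leftForm r i u (r j u) = if i = j then 1 else 0 := by
  have hdet := (Matrix.isUnit_iff_isUnit_det _).1 (h.isUnit_matrix hu)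
  have := congrFun (congrFun (Matrix.nonsing_inv_mul _ hdet) i) j
  rw [Matrix.one_apply] at this
  rw [← this]
  simp [leftForm, Matrix.mul_apply]

theorem leftForm_self (hu : u ∈ Ω) : leftForm r i u (r i u) = 1 := by
  simp [h.leftForm_eigenvector hu]

theorem exists_eq_sum (hu : u ∈ Ω) (v : State n) : ∃ c : Fin n → ℝ, v = ∑ j, c j • r j u := by
  have hs := (h.linearIndependent hu).span_eq_top_of_card_eq_finrank' (by simp)
  have : v ∈ Submodule.span ℝ (range fun j => r j u) := by rw [hs]; trivial
  obtain ⟨c, hc⟩ := (Submodule.mem_span_range_iff_exists_fun ℝ).1 this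
  exact ⟨c, hc.symm⟩

/-- `ℓ_i(u)` is a left eigenvector of `Df(u)`. -/
theorem leftForm_fderiv (hu : u ∈ Ω) (v : State n) :
    leftForm r i u (fderiv ℝ f u v) = lam i u * leftForm r i u v := by
  obtain ⟨c, rfl⟩ := h.exists_eq_sum hu v
  simp [map_sum, h.eigen u hu, h.leftForm_eigenvector hu, mul_comm]

/-- `λ_i(u)` is a simple eigenvalue: the kernel of `Df(u) - λ_i(u)` is transversal to that of
`ℓ_i(u)`. -/
theorem eq_zero_of_eigen (hu : u ∈ Ω) (hv : fderiv ℝ f u v = lam i u • v)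
    (hl : leftForm r i u v = 0) : v = 0 := by
  obtain ⟨c, rfl⟩ := h.exists_eq_sum hu v
  have h0 : ∑ j, (c j * (lam j u - lam i u)) • r j u = 0 := by
    simp only [map_sum, map_smul, h.eigen u hu, Finset.smul_sum] at hv
    rw [← sub_eq_zero, ← Finset.sum_sub_distrib] at hv
    rw [← hv]
    refine Finset.sum_congr rfl fun j _ => ?_
    module
  have h1 := Fintype.linearIndependent_iff.1 (h.linearIndependent hu) _ h0
  refine Finset.sum_eq_zero fun j _ => ?_
  by_cases hj : i = j
  · subst hj
    have : c i = 0 := by simpa [map_sum, h.leftForm_eigenvector hu] using hl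
    simp [this]
  · have : lam j u - lam i u ≠ 0 :=
      sub_ne_zero.2 fun e => hj ((h.strictMono u hu).injective e).symm
    simp [(mul_eq_zero.1 (h1 j)).resolve_right this]

theorem continuousAt_leftForm (hu : u ∈ Ω) : ContinuousAt (leftForm r i) u := by
  have hM : ContinuousAt
      (fun u => (Matrix.of fun a j => r j u a : Matrix (Fin n) (Fin n) ℝ)) u := by
    refine continuousAt_pi.2 fun a => continuousAt_pi.2 fun j => ?_
    exact continuousAt_pi.1 ((h.contDiffOn_eigenvector j).continuousOn.continuousAt
      (h.isOpen.mem_nhds hu)) a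
  have hdet := (Matrix.isUnit_iff_isUnit_det _).1 (h.isUnit_matrix hu)
  have hinv : ContinuousAt
      (fun u => (Matrix.of fun a j => r j u a : Matrix (Fin n) (Fin n) ℝ)⁻¹) u := by
    refine ContinuousAt.comp (g := Inv.inv) (continuousAt_matrix_inv _ ?_) hM
    simpa using continuousAt_inv₀ hdet.ne_zero
  unfold leftForm
  refine tendsto_finsetSum _ fun a _ => ?_
  exact Tendsto.smul_const (continuousAt_pi.1 (continuousAt_pi.1 hinv i) a) _

theorem contDiffAt_eigenvector (hu : u ∈ Ω) : ContDiffAt ℝ 1 (r i) u :=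
  (h.contDiffOn_eigenvector i).contDiffAt (h.isOpen.mem_nhds hu)

theorem contDiffAt_fderiv (hu : u ∈ Ω) : ContDiffAt ℝ 1 (fderiv ℝ f) u :=
  (h.contDiffOn_flux.contDiffAt (h.isOpen.mem_nhds hu)).fderiv_right (by norm_num)

/-- The eigenvalue is as smooth as `Df` and `r_i`, since `λ_i = ℓ(Df r_i) / ℓ(r_i)` for any fixed
covector `ℓ` not vanishing on `r_i`. -/
theorem contDiffAt_eigenvalue (hu : u ∈ Ω) : ContDiffAt ℝ 1 (lam i) u := by
  have hr := h.contDiffAt_eigenvector (i := i) hu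
  have h1 : ContDiffAt ℝ 1 (fun x => leftForm r i u (r i x)) u :=
    (leftForm r i u).contDiff.contDiffAt.comp u hr
  have h2 : ContDiffAt ℝ 1 (fun x => leftForm r i u (fderiv ℝ f x (r i x))) u :=
    (leftForm r i u).contDiff.contDiffAt.comp u ((h.contDiffAt_fderiv hu).clm_apply hr)
  have h3 := h.leftForm_self (i := i) hu
  refine (h2.div h1 (by simp [h3])).congr_of_eventuallyEq ?_
  have h4 : ∀ᶠ x in 𝓝 u, leftForm r i u (r i x) ≠ 0 :=
    h1.continuousAt.eventually_ne (by simp [h3])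
  filter_upwards [h4, h.isOpen.mem_nhds hu] with x hx hxΩ
  simp [h.eigen x hxΩ, hx]

end IsStrictlyHyperbolic
end ConservationLaw

/-! ### Uniform control of the field near a state -/

namespace ConservationLaw

/-- Quantitative control of the `i`-th field on a small closed ball `closedBall ubar ρ` (a cube, for
the sup norm). The constant `Q` bounds the data at `ubar`, including the inverse of the linear map
`(y, m) ↦ ((Df(ubar) - λ_i(ubar)) y - m r_i(ubar), ℓ_i(ubar) y)`, and on the ball all the data stay
within `1 / (1000 Q⁵)` of their values at `ubar`. -/
structure IsControlBall {n : ℕ} (f : State n → State n) (lam : Fin n → State n → ℝ)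
    (r : Fin n → State n → State n) (i : Fin n) (ubar : State n) (Q ρ : ℝ) : Prop where
  one_le : 1 ≤ Q
  pos : 0 < ρ
  radius_le : ρ ≤ 1 / (1000 * Q ^ 5)
  norm_eigenvector_le : ‖r i ubar‖ ≤ Q
  norm_leftForm_le : ‖leftForm r i ubar‖ ≤ Q
  bounded_below : ∀ (y : State n) (m : ℝ), ‖y‖ + |m| ≤
    Q * (‖fderiv ℝ f ubar y - lam i ubar • y - m • r i ubar‖ + |leftForm r i ubar y|)
  contDiffAt_flux : ∀ u ∈ Metric.closedBall ubar ρ, ContDiffAt ℝ 2 f u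
  contDiffAt_eigenvector : ∀ u ∈ Metric.closedBall ubar ρ, ContDiffAt ℝ 1 (r i) u
  contDiffAt_eigenvalue : ∀ u ∈ Metric.closedBall ubar ρ, ContDiffAt ℝ 1 (lam i) u
  eigen : ∀ u ∈ Metric.closedBall ubar ρ, fderiv ℝ f u (r i u) = lam i u • r i u
  leftForm_fderiv : ∀ u ∈ Metric.closedBall ubar ρ, ∀ v,
    leftForm r i u (fderiv ℝ f u v) = lam i u * leftForm r i u v
  leftForm_self : ∀ u ∈ Metric.closedBall ubar ρ, leftForm r i u (r i u) = 1
  mono : ∀ u ∈ Metric.closedBall ubar ρ, 0 ≤ fderiv ℝ (lam i) u (r i u)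
  norm_fderiv_eigenvalue_le : ∀ u ∈ Metric.closedBall ubar ρ, ‖fderiv ℝ (lam i) u‖ ≤ Q
  fderiv_sub_le : ∀ u ∈ Metric.closedBall ubar ρ,
    ‖fderiv ℝ f u - fderiv ℝ f ubar‖ ≤ 1 / (1000 * Q ^ 5)
  eigenvalue_sub_le : ∀ u ∈ Metric.closedBall ubar ρ,
    |lam i u - lam i ubar| ≤ 1 / (1000 * Q ^ 5)
  eigenvector_sub_le : ∀ u ∈ Metric.closedBall ubar ρ,
    ‖r i u - r i ubar‖ ≤ 1 / (1000 * Q ^ 5)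
  leftForm_sub_le : ∀ u ∈ Metric.closedBall ubar ρ,
    ‖leftForm r i u - leftForm r i ubar‖ ≤ 1 / (1000 * Q ^ 5)

variable {n : ℕ} {f : State n → State n} {Ω : Set (State n)} {lam : Fin n → State n → ℝ}
  {r : Fin n → State n → State n} {i : Fin n}

/-- The linearization at `(r_i(u), λ_i(u))` of the normalized eigenvalue problem
`(w, σ) ↦ (Df(u) w - σ w, ℓ_i(u) w)`. -/
def eigenLinearization (f : State n → State n) (lam : Fin n → State n → ℝ)
    (r : Fin n → State n → State n) (i : Fin n) (u : State n) :
    State n × ℝ →L[ℝ] State n × ℝ :=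
  ((fderiv ℝ f u - lam i u • ContinuousLinearMap.id ℝ (State n)).comp
      (ContinuousLinearMap.fst ℝ (State n) ℝ) -
    (ContinuousLinearMap.snd ℝ (State n) ℝ).smulRight (r i u)).prod
  ((leftForm r i u).comp (ContinuousLinearMap.fst ℝ (State n) ℝ))

@[simp]
theorem eigenLinearization_apply (u : State n) (z : State n × ℝ) :
    eigenLinearization f lam r i u z =
      (fderiv ℝ f u z.1 - lam i u • z.1 - z.2 • r i u, leftForm r i u z.1) := by
  simp [eigenLinearization]

theorem IsStrictlyHyperbolic.exists_bounded_below (h : IsStrictlyHyperbolic f Ω lam r)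
    {u : State n} (hu : u ∈ Ω) : ∃ C : ℝ, 0 ≤ C ∧ ∀ (y : State n) (m : ℝ), ‖y‖ + |m| ≤
      C * (‖fderiv ℝ f u y - lam i u • y - m • r i u‖ + |leftForm r i u y|) := by
  have hker : LinearMap.ker
      (eigenLinearization f lam r i u : State n × ℝ →ₗ[ℝ] State n × ℝ) = ⊥ := by
    refine LinearMap.ker_eq_bot'.2 fun z hz => ?_
    have hz' : eigenLinearization f lam r i u z = 0 := hz
    rw [eigenLinearization_apply, Prod.mk_eq_zero] at hz'
    obtain ⟨h1, h2⟩ := hz'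
    have h3 := congrArg (leftForm r i u) h1
    simp only [map_sub, map_smul, h.leftForm_fderiv hu, h.leftForm_self hu, h2, map_zero,
      smul_eq_mul] at h3
    have h4 : z.2 = 0 := by linarith
    have h5 : z.1 = 0 := h.eq_zero_of_eigen hu (by simpa [h4, sub_eq_zero] using h1) h2
    exact Prod.ext h5 h4
  obtain ⟨K, -, hK⟩ := LinearMap.exists_antilipschitzWith _ hker
  refine ⟨2 * K, by positivity, fun y m => ?_⟩
  have h1 : ‖(y, m)‖ ≤ K * ‖eigenLinearization f lam r i u (y, m)‖ := by
    have := hK.le_mul_dist (y, m) 0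
    rwa [map_zero, dist_zero_right, dist_zero_right] at this
  rw [eigenLinearization_apply] at h1
  have h2 : ‖y‖ ≤ ‖(y, m)‖ := norm_fst_le (y, m)
  have h3 : |m| ≤ ‖(y, m)‖ := norm_snd_le (y, m)
  have h4 : ‖(fderiv ℝ f u y - lam i u • y - m • r i u, leftForm r i u y)‖ ≤
      ‖fderiv ℝ f u y - lam i u • y - m • r i u‖ + |leftForm r i u y| :=
    max_le_add_of_nonneg (norm_nonneg _) (norm_nonneg _)
  have h5 := mul_le_mul_of_nonneg_left h4 K.coe_nonneg
  simp only at h1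
  linarith

theorem IsStrictlyHyperbolic.exists_isControlBall (h : IsStrictlyHyperbolic f Ω lam r)
    (hmono : IsMonotoneField Ω lam r i) {ubar : State n} (hu : ubar ∈ Ω) :
    ∃ Q ρ : ℝ, IsControlBall f lam r i ubar Q ρ ∧ Metric.closedBall ubar ρ ⊆ Ω := by
  obtain ⟨C, hC, hbelow⟩ := h.exists_bounded_below (i := i) hu
  obtain ⟨Q, hQ⟩ : ∃ Q, Q = 1 + C + ‖r i ubar‖ + ‖leftForm r i ubar‖ +
    ‖fderiv ℝ (lam i) ubar‖ := ⟨_, rfl⟩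
  have n1 := norm_nonneg (r i ubar)
  have n2 := norm_nonneg (leftForm r i ubar)
  have n3 := norm_nonneg (fderiv ℝ (lam i) ubar)
  have hQ1 : 1 ≤ Q := by linarith
  have hε : 0 < 1 / (1000 * Q ^ 5) := by positivity
  have e1 : ∀ᶠ u in 𝓝 ubar, u ∈ Ω := h.isOpen.mem_nhds hu
  have e2 : ∀ᶠ u in 𝓝 ubar, ‖fderiv ℝ (lam i) u‖ ≤ Q := by
    have : ContinuousAt (fun u => ‖fderiv ℝ (lam i) u‖) ubar :=
      ((h.contDiffAt_eigenvalue hu).fderiv_right (m := 0) (by norm_num)).continuousAt.norm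
    exact (this.eventually_lt_const (by linarith)).mono fun u hu => hu.le
  have e3 := Metric.continuousAt_iff'.1 (h.contDiffAt_fderiv hu).continuousAt _ hε
  have e4 := Metric.continuousAt_iff'.1 (h.contDiffAt_eigenvalue (i := i) hu).continuousAt _ hε
  have e5 := Metric.continuousAt_iff'.1 (h.contDiffAt_eigenvector (i := i) hu).continuousAt _ hε
  have e6 := Metric.continuousAt_iff'.1 (h.continuousAt_leftForm (i := i) hu) _ hε
  obtain ⟨ρ, hρ, hball⟩ := Metric.nhds_basis_closedBall.eventually_iff.1
    (e1.and (e2.and (e3.and (e4.and (e5.and e6)))))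
  have hsub : Metric.closedBall ubar (min ρ (1 / (1000 * Q ^ 5))) ⊆ Metric.closedBall ubar ρ :=
    Metric.closedBall_subset_closedBall (min_le_left _ _)
  have hΩ : ∀ u ∈ Metric.closedBall ubar (min ρ (1 / (1000 * Q ^ 5))), u ∈ Ω :=
    fun u hu => (hball (hsub hu)).1
  refine ⟨Q, min ρ (1 / (1000 * Q ^ 5)), ?_, hΩ⟩
  exact
    { one_le := hQ1
      pos := lt_min hρ hε
      radius_le := min_le_right _ _
      norm_eigenvector_le := by linarith
      norm_leftForm_le := by linarith
      bounded_below := fun y m => (hbelow y m).trans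
        (mul_le_mul_of_nonneg_right (by linarith) (by positivity))
      contDiffAt_flux := fun u hu => h.contDiffOn_flux.contDiffAt (h.isOpen.mem_nhds (hΩ u hu))
      contDiffAt_eigenvector := fun u hu => h.contDiffAt_eigenvector (hΩ u hu)
      contDiffAt_eigenvalue := fun u hu => h.contDiffAt_eigenvalue (hΩ u hu)
      eigen := fun u hu => h.eigen u (hΩ u hu) i
      leftForm_fderiv := fun u hu => h.leftForm_fderiv (hΩ u hu)
      leftForm_self := fun u hu => h.leftForm_self (hΩ u hu)
      mono := fun u hu => hmono u (hΩ u hu)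
      norm_fderiv_eigenvalue_le := fun u hu => (hball (hsub hu)).2.1
      fderiv_sub_le := fun u hu => by
        simpa only [dist_eq_norm] using (hball (hsub hu)).2.2.1.le
      eigenvalue_sub_le := fun u hu => by
        simpa only [Real.dist_eq] using (hball (hsub hu)).2.2.2.1.le
      eigenvector_sub_le := fun u hu => by
        simpa only [dist_eq_norm] using (hball (hsub hu)).2.2.2.2.1.le
      leftForm_sub_le := fun u hu => by
        simpa only [dist_eq_norm] using (hball (hsub hu)).2.2.2.2.2.le }

end ConservationLaw

/-! ### The rescaled Rankine-Hugoniot relation -/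

namespace ConservationLaw
variable {n : ℕ} {f : State n → State n} {lam : Fin n → State n → ℝ}
  {r : Fin n → State n → State n} {i : Fin n}

/-- The Rankine-Hugoniot relation at `u₀ + s w` with speed `σ`, divided by `s`, together with the
normalization `ℓ_i(u₀) w = 1`: it reads `rankineHugoniotMap f r i u₀ s (w, σ) = (0, 1)`. At `s = 0`
the difference quotient of `f` is replaced by its limit `Df(u₀) w`. -/
def rankineHugoniotMap (f : State n → State n) (r : Fin n → State n → State n) (i : Fin n)
    (u₀ : State n) (s : ℝ) (z : State n × ℝ) : State n × ℝ :=
  ((if s = 0 then fderiv ℝ f u₀ z.1 else s⁻¹ • (f (u₀ + s • z.1) - f u₀)) - z.2 • z.1,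
    leftForm r i u₀ z.1)

theorem rankineHugoniotMap_eq_iff {u₀ w : State n} {s σ : ℝ} (hs : s ≠ 0) :
    rankineHugoniotMap f r i u₀ s (w, σ) = (0, 1) ↔
      f (u₀ + s • w) - f u₀ = σ • (s • w) ∧ leftForm r i u₀ w = 1 := by
  simp only [rankineHugoniotMap, hs, if_false, Prod.mk.injEq, sub_eq_zero, inv_smul_eq_iff₀ hs,
    smul_comm σ s]

theorem one_div_mul_pow_le {Q : ℝ} (hQ : 1 ≤ Q) {k : ℕ} (hk : k ≤ 5) :
    1 / (1000 * Q ^ 5) * Q ^ k ≤ 1 / 1000 := by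
  have h0 : 0 < Q := by linarith
  have : Q ^ k ≤ Q ^ 5 := pow_le_pow_right₀ hQ hk
  rw [div_mul_eq_mul_div, div_le_div_iff₀ (by positivity) (by norm_num)]
  linarith

namespace IsControlBall
variable {ubar : State n} {Q ρ : ℝ} (h : IsControlBall f lam r i ubar Q ρ)
include h

local notation "B" => Metric.closedBall ubar ρ
local notation "δ₀" => 1 / (1000 * Q ^ 5)

theorem center_mem : ubar ∈ B := Metric.mem_closedBall_self h.pos.le

theorem eps_pos : 0 < δ₀ := by
  have := h.one_le
  positivity

theorem eps_le : δ₀ ≤ 1 / 1000 := by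
  simpa using one_div_mul_pow_le h.one_le (k := 0) (by norm_num)

theorem hasFDerivAt {u : State n} (hu : u ∈ B) : HasFDerivAt f (fderiv ℝ f u) u :=
  ((h.contDiffAt_flux u hu).differentiableAt (by norm_num)).hasFDerivAt

/-- On the ball, `f` is close to the linear map `Df(ubar)`. -/
theorem norm_flux_sub_le {x y : State n} (hx : x ∈ B) (hy : y ∈ B) :
    ‖f y - f x - fderiv ℝ f ubar (y - x)‖ ≤ δ₀ * ‖y - x‖ :=
  Convex.norm_image_sub_le_of_norm_hasFDerivWithin_le'
    (fun _ hu => (h.hasFDerivAt hu).hasFDerivWithinAt) h.fderiv_sub_le (convex_closedBall _ _) hx hy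

theorem abs_leftForm_sub_le {u : State n} (hu : u ∈ B) (w : State n) :
    |leftForm r i u w - leftForm r i ubar w| ≤ δ₀ * ‖w‖ :=
  ((leftForm r i u - leftForm r i ubar).le_opNorm w).trans
    (mul_le_mul_of_nonneg_right (h.leftForm_sub_le u hu) (norm_nonneg w))

theorem abs_leftForm_le {u : State n} (hu : u ∈ B) (w : State n) :
    |leftForm r i u w| ≤ 2 * Q * ‖w‖ := by
  have h1 := h.abs_leftForm_sub_le hu w
  have h2 : |leftForm r i ubar w| ≤ Q * ‖w‖ := ((leftForm r i ubar).le_opNorm w).trans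
    (mul_le_mul_of_nonneg_right h.norm_leftForm_le (norm_nonneg w))
  have h3 := abs_sub_abs_le_abs_sub (leftForm r i u w) (leftForm r i ubar w)
  have h4 : δ₀ * ‖w‖ ≤ Q * ‖w‖ :=
    mul_le_mul_of_nonneg_right (by linarith [h.eps_le, h.one_le]) (norm_nonneg w)
  linarith

/-- A priori estimate: as soon as its speed is in the right range, a state of the Hugoniot locus of
`u₀` is close to the line through `u₀` spanned by `r_i(ubar)`, and its speed is much closer to
`λ_i(ubar)` than assumed. -/
theorem rankineHugoniot_estimate {u₀ w : State n} {s σ : ℝ} (hu₀ : u₀ ∈ B) (hs : s ≠ 0)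
    (hu : u₀ + s • w ∈ B) (hz : rankineHugoniotMap f r i u₀ s (w, σ) = (0, 1))
    (hσ : |σ - lam i ubar| ≤ 1 / (4 * Q)) :
    ‖w - r i ubar‖ + |σ - lam i ubar| ≤ 4 * Q ^ 2 * δ₀ := by
  obtain ⟨hRH, hl⟩ := (rankineHugoniotMap_eq_iff hs).1 hz
  have hQ := h.one_le
  have hQ0 : 0 < Q := by linarith
  have hε := h.eps_pos
  have hc := h.center_mem
  -- `e` is the deviation of `f` from its linearization at `ubar`, divided by `s`
  obtain ⟨e, he⟩ : ∃ e, e = s⁻¹ • (f (u₀ + s • w) - f u₀ - fderiv ℝ f ubar (s • w)) := ⟨_, rfl⟩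
  have he1 : ‖e‖ ≤ δ₀ * ‖w‖ := by
    have := h.norm_flux_sub_le hu₀ hu
    rw [add_sub_cancel_left] at this
    rw [he, norm_smul, norm_inv, inv_mul_le_iff₀ (norm_pos_iff.2 hs)]
    rw [norm_smul] at this
    linarith
  have he2 : fderiv ℝ f ubar w = σ • w - e := by
    rw [he, hRH, map_smul, ← smul_comm s σ, ← smul_sub, inv_smul_smul₀ hs]
    abel
  have h1 := h.bounded_below (w - r i ubar) (σ - lam i ubar)
  have h2 : fderiv ℝ f ubar (w - r i ubar) - lam i ubar • (w - r i ubar) -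
      (σ - lam i ubar) • r i ubar = (σ - lam i ubar) • (w - r i ubar) - e := by
    rw [map_sub, he2, h.eigen ubar hc]
    module
  have h3 : leftForm r i ubar (w - r i ubar) = leftForm r i ubar w - leftForm r i u₀ w := by
    rw [map_sub, h.leftForm_self ubar hc, hl]
  have h4 : |leftForm r i ubar w - leftForm r i u₀ w| ≤ δ₀ * ‖w‖ := by
    rw [abs_sub_comm]
    exact h.abs_leftForm_sub_le hu₀ w
  have h5 : ‖(σ - lam i ubar) • (w - r i ubar) - e‖ ≤
      1 / (4 * Q) * ‖w - r i ubar‖ + δ₀ * ‖w‖ := by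
    refine (norm_sub_le _ _).trans (add_le_add ?_ he1)
    rw [norm_smul]
    exact mul_le_mul_of_nonneg_right hσ (norm_nonneg _)
  have h6 : ‖w‖ ≤ ‖w - r i ubar‖ + Q := by
    have := norm_add_le (w - r i ubar) (r i ubar)
    rw [sub_add_cancel] at this
    linarith [h.norm_eigenvector_le]
  rw [h2, h3] at h1
  have h7 : Q * (‖(σ - lam i ubar) • (w - r i ubar) - e‖ +
      |leftForm r i ubar w - leftForm r i u₀ w|) ≤
      Q * (1 / (4 * Q) * ‖w - r i ubar‖ + δ₀ * ‖w‖ + δ₀ * ‖w‖) :=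
    mul_le_mul_of_nonneg_left (by linarith) hQ0.le
  have h8 : Q * (1 / (4 * Q) * ‖w - r i ubar‖ + δ₀ * ‖w‖ + δ₀ * ‖w‖) =
      ‖w - r i ubar‖ / 4 + 2 * (δ₀ * Q ^ 1) * ‖w‖ := by
    field_simp
    ring
  have h9 : δ₀ * Q ^ 1 ≤ 1 / 1000 := one_div_mul_pow_le hQ (by norm_num)
  have h10 : 2 * (δ₀ * Q ^ 1) * ‖w‖ ≤ 2 * (δ₀ * Q ^ 1) * (‖w - r i ubar‖ + Q) :=
    mul_le_mul_of_nonneg_left h6 (by positivity)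
  have h11 : δ₀ * Q ^ 1 * ‖w - r i ubar‖ ≤ 1 / 1000 * ‖w - r i ubar‖ :=
    mul_le_mul_of_nonneg_right h9 (norm_nonneg _)
  have h12 := abs_nonneg (σ - lam i ubar)
  have h13 := norm_nonneg (w - r i ubar)
  nlinarith

/-- The a priori estimate puts solutions in the ball where the rescaled map is injective. -/
theorem estimate_le_radius : 4 * Q ^ 2 * δ₀ ≤ 1 / (16 * Q) := by
  have hQ := h.one_le
  have h1 : δ₀ * Q ^ 3 ≤ 1 / 1000 := one_div_mul_pow_le hQ (by norm_num)
  rw [le_div_iff₀ (by positivity)]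
  nlinarith

/-- The rescaled Rankine-Hugoniot map is close, near `(r_i(ubar), λ_i(ubar))`, to the linearized
eigenvalue problem at `ubar`, uniformly in `u₀` and `s`. -/
theorem norm_rankineHugoniotMap_sub_le {u₀ : State n} {s : ℝ} (hu₀ : u₀ ∈ B)
    {z₁ z₂ : State n × ℝ} (hz₁ : u₀ + s • z₁.1 ∈ B) (hz₂ : u₀ + s • z₂.1 ∈ B)
    (hb₁ : z₁ ∈ Metric.closedBall (r i ubar, lam i ubar) (1 / (16 * Q)))
    (hb₂ : z₂ ∈ Metric.closedBall (r i ubar, lam i ubar) (1 / (16 * Q))) :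
    ‖rankineHugoniotMap f r i u₀ s z₁ - rankineHugoniotMap f r i u₀ s z₂ -
      eigenLinearization f lam r i ubar (z₁ - z₂)‖ ≤ 1 / (4 * Q) * ‖z₁ - z₂‖ := by
  obtain ⟨w₁, σ₁⟩ := z₁
  obtain ⟨w₂, σ₂⟩ := z₂
  have hQ := h.one_le
  have hQ0 : 0 < Q := by linarith
  have hε := h.eps_pos
  have hεQ : δ₀ ≤ 1 / (16 * Q) := by
    have h1 : δ₀ * Q ^ 1 ≤ 1 / 1000 := one_div_mul_pow_le hQ (by norm_num)
    rw [le_div_iff₀ (by positivity)]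
    linarith
  have hδ : 1 / (4 * Q) = 4 * (1 / (16 * Q)) := by
    field_simp
    norm_num
  rw [mem_closedBall_iff_norm, Prod.mk_sub_mk, Prod.norm_mk, max_le_iff, Real.norm_eq_abs]
    at hb₁ hb₂
  simp only at hz₁ hz₂
  have hN1 : ‖w₁ - w₂‖ ≤ ‖(w₁, σ₁) - (w₂, σ₂)‖ := norm_fst_le ((w₁, σ₁) - (w₂, σ₂))
  have hN2 : |σ₁ - σ₂| ≤ ‖(w₁, σ₁) - (w₂, σ₂)‖ := norm_snd_le ((w₁, σ₁) - (w₂, σ₂))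
  have hN := norm_nonneg ((w₁, σ₁) - (w₂, σ₂))
  have hG : ‖(if s = 0 then fderiv ℝ f u₀ w₁ else s⁻¹ • (f (u₀ + s • w₁) - f u₀)) -
      (if s = 0 then fderiv ℝ f u₀ w₂ else s⁻¹ • (f (u₀ + s • w₂) - f u₀)) -
      fderiv ℝ f ubar (w₁ - w₂)‖ ≤ δ₀ * ‖w₁ - w₂‖ := by
    split_ifs with hs
    · rw [← map_sub]
      exact ((fderiv ℝ f u₀ - fderiv ℝ f ubar).le_opNorm _).trans
        (mul_le_mul_of_nonneg_right (h.fderiv_sub_le u₀ hu₀) (norm_nonneg _))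
    · have h1 := h.norm_flux_sub_le hz₂ hz₁
      rw [add_sub_add_left_eq_sub, ← smul_sub] at h1
      have h2 : s⁻¹ • (f (u₀ + s • w₁) - f u₀) - s⁻¹ • (f (u₀ + s • w₂) - f u₀) -
          fderiv ℝ f ubar (w₁ - w₂) =
          s⁻¹ • (f (u₀ + s • w₁) - f (u₀ + s • w₂) - fderiv ℝ f ubar (s • (w₁ - w₂))) := by
        rw [map_smul, smul_sub s⁻¹ _ (s • _), inv_smul_smul₀ hs]
        module
      rw [h2, norm_smul, norm_inv, inv_mul_le_iff₀ (norm_pos_iff.2 hs)]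
      rw [norm_smul] at h1
      linarith
  obtain ⟨g, hg⟩ : ∃ g, g = (if s = 0 then fderiv ℝ f u₀ w₁ else s⁻¹ • (f (u₀ + s • w₁) - f u₀)) -
      (if s = 0 then fderiv ℝ f u₀ w₂ else s⁻¹ • (f (u₀ + s • w₂) - f u₀)) -
      fderiv ℝ f ubar (w₁ - w₂) := ⟨_, rfl⟩
  have hval : rankineHugoniotMap f r i u₀ s (w₁, σ₁) - rankineHugoniotMap f r i u₀ s (w₂, σ₂) -
      eigenLinearization f lam r i ubar ((w₁, σ₁) - (w₂, σ₂)) =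
      (g - (σ₁ - lam i ubar) • (w₁ - w₂) - (σ₁ - σ₂) • (w₂ - r i ubar),
        leftForm r i u₀ (w₁ - w₂) - leftForm r i ubar (w₁ - w₂)) := by
    rw [eigenLinearization_apply, hg]
    simp only [rankineHugoniotMap, Prod.mk_sub_mk, map_sub, Prod.mk.injEq]
    exact ⟨by module, trivial⟩
  rw [hval, Prod.norm_mk]
  refine max_le ?_ ?_
  · have h1 : ‖(σ₁ - lam i ubar) • (w₁ - w₂)‖ ≤ 1 / (16 * Q) * ‖(w₁, σ₁) - (w₂, σ₂)‖ := by
      rw [norm_smul]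
      exact mul_le_mul hb₁.2 hN1 (norm_nonneg _) (by positivity)
    have h2 : ‖(σ₁ - σ₂) • (w₂ - r i ubar)‖ ≤ 1 / (16 * Q) * ‖(w₁, σ₁) - (w₂, σ₂)‖ := by
      rw [norm_smul, mul_comm]
      exact mul_le_mul hb₂.1 hN2 (norm_nonneg _) (by positivity)
    have h3 : ‖g‖ ≤ 1 / (16 * Q) * ‖(w₁, σ₁) - (w₂, σ₂)‖ := by
      rw [hg]
      exact hG.trans (mul_le_mul hεQ hN1 (norm_nonneg _) (by positivity))
    have h4 := norm_sub_le (g - (σ₁ - lam i ubar) • (w₁ - w₂)) ((σ₁ - σ₂) • (w₂ - r i ubar))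
    have h5 := norm_sub_le g ((σ₁ - lam i ubar) • (w₁ - w₂))
    rw [hδ]
    have : 0 ≤ 1 / (16 * Q) * ‖(w₁, σ₁) - (w₂, σ₂)‖ := by positivity
    linarith
  · refine (h.abs_leftForm_sub_le hu₀ _).trans ?_
    refine mul_le_mul ?_ hN1 (norm_nonneg _) (by positivity)
    rw [hδ]
    linarith

theorem norm_le_eigenLinearization (z : State n × ℝ) :
    ‖z‖ ≤ 2 * Q * ‖eigenLinearization f lam r i ubar z‖ := by
  have hQ := h.one_le
  have h1 := h.bounded_below z.1 z.2
  have h2 := norm_fst_le (eigenLinearization f lam r i ubar z)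
  have h3 : |_| ≤ _ := norm_snd_le (eigenLinearization f lam r i ubar z)
  rw [eigenLinearization_apply] at h2 h3 ⊢
  have h4 : ‖z‖ ≤ ‖z.1‖ + |z.2| := max_le_add_of_nonneg (norm_nonneg _) (norm_nonneg _)
  refine (h4.trans h1).trans ?_
  rw [mul_comm 2 Q, mul_assoc]
  exact mul_le_mul_of_nonneg_left (by linarith) (by linarith)

/-- The rescaled Rankine-Hugoniot map is injective near `(r_i(ubar), λ_i(ubar))`, with a uniform
bound for its inverse. -/
theorem norm_sub_le_rankineHugoniotMap {u₀ : State n} {s : ℝ} (hu₀ : u₀ ∈ B)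
    {z₁ z₂ : State n × ℝ} (hz₁ : u₀ + s • z₁.1 ∈ B) (hz₂ : u₀ + s • z₂.1 ∈ B)
    (hb₁ : z₁ ∈ Metric.closedBall (r i ubar, lam i ubar) (1 / (16 * Q)))
    (hb₂ : z₂ ∈ Metric.closedBall (r i ubar, lam i ubar) (1 / (16 * Q))) :
    ‖z₁ - z₂‖ ≤ 4 * Q * ‖rankineHugoniotMap f r i u₀ s z₁ - rankineHugoniotMap f r i u₀ s z₂‖ := by
  have hQ0 : 0 < Q := by linarith [h.one_le]
  have h1 := h.norm_rankineHugoniotMap_sub_le hu₀ hz₁ hz₂ hb₁ hb₂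
  have h2 := h.norm_le_eigenLinearization (z₁ - z₂)
  have h3 := norm_le_norm_add_norm_sub
    (rankineHugoniotMap f r i u₀ s z₁ - rankineHugoniotMap f r i u₀ s z₂)
    (eigenLinearization f lam r i ubar (z₁ - z₂))
  have h4 := mul_le_mul_of_nonneg_left (h3.trans (add_le_add_right h1 _))
    (by positivity : 0 ≤ 2 * Q)
  have h5 : 2 * Q * (1 / (4 * Q) * ‖z₁ - z₂‖) = ‖z₁ - z₂‖ / 2 := by
    field_simp
    norm_num
  rw [mul_add, h5] at h4
  linarith

/-- Solvability of the rescaled Rankine-Hugoniot relation, for `s` so small that all the candidate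
states lie in the ball. -/
theorem exists_rankineHugoniotMap_eq {u₀ : State n} {s : ℝ} (hu₀ : u₀ ∈ B)
    (hs : ∀ z ∈ Metric.closedBall (r i ubar, lam i ubar) (1 / (16 * Q)), u₀ + s • z.1 ∈ B) :
    ∃ z ∈ Metric.closedBall (r i ubar, lam i ubar) (1 / (16 * Q)),
      rankineHugoniotMap f r i u₀ s z = (0, 1) := by
  have hQ := h.one_le
  have hQ0 : 0 < Q := by linarith
  have hc := h.center_mem
  have hinj : Function.Injective (eigenLinearization f lam r i ubar) := by
    refine (injective_iff_map_eq_zero _).2 fun z hz => ?_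
    have := h.norm_le_eigenLinearization z
    rw [hz, norm_zero, mul_zero] at this
    exact norm_le_zero_iff.1 this
  obtain ⟨g, hg⟩ := (LinearMap.injective_iff_surjective
    (f := (eigenLinearization f lam r i ubar : State n × ℝ →ₗ[ℝ] State n × ℝ))).1
      hinj |>.hasRightInverse
  have hg' : ∀ y, eigenLinearization f lam r i ubar (g y) = y := hg
  let R : (eigenLinearization f lam r i ubar).NonlinearRightInverse :=
    { toFun := g
      nnnorm := ⟨2 * Q, by positivity⟩
      bound' := fun y => by
        have := h.norm_le_eigenLinearization (g y)
        rwa [hg'] at this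
      right_inv' := hg' }
  have happ : ApproximatesLinearOn (rankineHugoniotMap f r i u₀ s)
      (eigenLinearization f lam r i ubar)
      (Metric.closedBall (r i ubar, lam i ubar) (1 / (16 * Q))) ⟨1 / (4 * Q), by positivity⟩ :=
    ApproximatesLinearOn.approximatesLinearOn_iff_lipschitzOnWith.2 <|
      LipschitzOnWith.of_dist_le_mul fun x hx y hy => by
      have := h.norm_rankineHugoniotMap_sub_le hu₀ (hs x hx) (hs y hy) hx hy
      rw [dist_eq_norm, dist_eq_norm]
      convert! this using 2
      simp only [Pi.sub_apply, map_sub]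
      abel
  have hsurj : SurjOn (rankineHugoniotMap f r i u₀ s)
      (Metric.closedBall (r i ubar, lam i ubar) (1 / (16 * Q)))
      (Metric.closedBall (rankineHugoniotMap f r i u₀ s (r i ubar, lam i ubar))
        (((2 * Q)⁻¹ - 1 / (4 * Q)) * (1 / (16 * Q)))) :=
    happ.surjOn_closedBall_of_nonlinearRightInverse R (by positivity) Subset.rfl
  have hrad : ((2 * Q)⁻¹ - 1 / (4 * Q)) * (1 / (16 * Q)) = 1 / (64 * Q ^ 2) := by
    field_simp
    norm_num
  rw [hrad] at hsurj
  refine hsurj ?_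
  have hr := hs (r i ubar, lam i ubar) (Metric.mem_closedBall_self (by positivity))
  simp only at hr
  have hε : δ₀ * Q ≤ 1 / (64 * Q ^ 2) := by
    have h1 : δ₀ * Q ^ 3 ≤ 1 / 1000 := one_div_mul_pow_le hQ (by norm_num)
    rw [le_div_iff₀ (by positivity)]
    linarith
  have hεr : δ₀ * ‖r i ubar‖ ≤ δ₀ * Q :=
    mul_le_mul_of_nonneg_left h.norm_eigenvector_le h.eps_pos.le
  rw [mem_closedBall_iff_norm', rankineHugoniotMap, Prod.mk_sub_mk, Prod.norm_mk]
  refine max_le ?_ ?_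
  · rw [sub_zero, ← h.eigen ubar hc]
    split_ifs with hs0
    · refine (((fderiv ℝ f u₀ - fderiv ℝ f ubar).le_opNorm (r i ubar)).trans
        (mul_le_mul_of_nonneg_right (h.fderiv_sub_le u₀ hu₀) (norm_nonneg _))).trans ?_
      linarith
    · have h1 := h.norm_flux_sub_le hu₀ hr
      rw [add_sub_cancel_left] at h1
      have h2 : s⁻¹ • (f (u₀ + s • r i ubar) - f u₀) - fderiv ℝ f ubar (r i ubar) =
          s⁻¹ • (f (u₀ + s • r i ubar) - f u₀ - fderiv ℝ f ubar (s • r i ubar)) := by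
        rw [map_smul, smul_sub s⁻¹ _ (s • _), inv_smul_smul₀ hs0]
      rw [h2, norm_smul, norm_inv, inv_mul_le_iff₀ (norm_pos_iff.2 hs0)]
      rw [norm_smul] at h1
      refine h1.trans ?_
      rw [mul_left_comm]
      exact mul_le_mul_of_nonneg_left (hεr.trans hε) (norm_nonneg s)
  · have := h.abs_leftForm_sub_le hu₀ (r i ubar)
    rw [h.leftForm_self ubar hc] at this
    exact this.trans (hεr.trans hε)

end IsControlBall
end ConservationLaw

/-! ### The differentiated Rankine-Hugoniot relation -/

namespace ConservationLaw
variable {n : ℕ} {f : State n → State n} {lam : Fin n → State n → ℝ}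
  {r : Fin n → State n → State n} {i : Fin n}

namespace IsControlBall
variable {ubar : State n} {Q ρ : ℝ} (h : IsControlBall f lam r i ubar Q ρ)
include h

local notation "B" => Metric.closedBall ubar ρ
local notation "δ₀" => 1 / (1000 * Q ^ 5)

/-- The derivative of the Rankine-Hugoniot relation along the Hugoniot curve is invertible, with
uniform bounds once its last component is rescaled by the parameter. -/
theorem linearized_bounded_below {u₀ u w : State n} {σ : ℝ} (hu₀ : u₀ ∈ B) (hu : u ∈ B)
    (hw : ‖w - r i ubar‖ + |σ - lam i ubar| ≤ 4 * Q ^ 2 * δ₀) (y : State n) (m : ℝ) :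
    ‖fderiv ℝ f ubar y - lam i ubar • y - m • r i ubar - (fderiv ℝ f u y - σ • y - m • w)‖ +
        |leftForm r i ubar y - leftForm r i u₀ y| ≤ 6 * Q ^ 2 * δ₀ * (‖y‖ + |m|) ∧
      ‖y‖ + |m| ≤ 2 * Q * (‖fderiv ℝ f u y - σ • y - m • w‖ + |leftForm r i u₀ y|) := by
  have hQ := h.one_le
  have hε := h.eps_pos
  have hy := norm_nonneg y
  have hm := abs_nonneg m
  have h1 : ‖fderiv ℝ f ubar y - fderiv ℝ f u y‖ ≤ δ₀ * ‖y‖ := by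
    rw [norm_sub_rev]
    exact ((fderiv ℝ f u - fderiv ℝ f ubar).le_opNorm y).trans
      (mul_le_mul_of_nonneg_right (h.fderiv_sub_le u hu) hy)
  have h2 : ‖(σ - lam i ubar) • y‖ ≤ 4 * Q ^ 2 * δ₀ * ‖y‖ := by
    rw [norm_smul]
    exact mul_le_mul_of_nonneg_right 
      (by linarith [norm_nonneg (w - r i ubar), Real.norm_eq_abs (σ - lam i ubar)]) hy
  have h3 : ‖m • (w - r i ubar)‖ ≤ 4 * Q ^ 2 * δ₀ * |m| := by
    rw [norm_smul, mul_comm]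
    exact mul_le_mul_of_nonneg_right (by linarith [abs_nonneg (σ - lam i ubar)]) hm
  have h4 : |leftForm r i ubar y - leftForm r i u₀ y| ≤ δ₀ * ‖y‖ := by
    rw [abs_sub_comm]
    exact h.abs_leftForm_sub_le hu₀ y
  have h5 : fderiv ℝ f ubar y - lam i ubar • y - m • r i ubar - (fderiv ℝ f u y - σ • y - m • w) =
      fderiv ℝ f ubar y - fderiv ℝ f u y + (σ - lam i ubar) • y + m • (w - r i ubar) := by
    module
  have h6 := norm_add₃_le (a := fderiv ℝ f ubar y - fderiv ℝ f u y) (b := (σ - lam i ubar) • y)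
    (c := m • (w - r i ubar))
  have h7 : δ₀ * ‖y‖ ≤ Q ^ 2 * δ₀ * ‖y‖ :=
    mul_le_mul_of_nonneg_right (le_mul_of_one_le_left hε.le (one_le_pow₀ hQ)) hy
  have hm' : 0 ≤ Q ^ 2 * δ₀ * |m| := by positivity
  have hA : ‖fderiv ℝ f ubar y - lam i ubar • y - m • r i ubar -
      (fderiv ℝ f u y - σ • y - m • w)‖ + |leftForm r i ubar y - leftForm r i u₀ y| ≤
      6 * Q ^ 2 * δ₀ * (‖y‖ + |m|) := by
    rw [h5]
    linarith
  refine ⟨hA, ?_⟩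
  have h8 := h.bounded_below y m
  have h9 := norm_sub_norm_le (fderiv ℝ f ubar y - lam i ubar • y - m • r i ubar)
    (fderiv ℝ f u y - σ • y - m • w)
  have h10 := abs_sub_abs_le_abs_sub (leftForm r i ubar y) (leftForm r i u₀ y)
  have h11 : Q * (‖fderiv ℝ f ubar y - lam i ubar • y - m • r i ubar‖ + |leftForm r i ubar y|) ≤
      Q * ((‖fderiv ℝ f u y - σ • y - m • w‖ + |leftForm r i u₀ y|) +
        6 * Q ^ 2 * δ₀ * (‖y‖ + |m|)) :=
    mul_le_mul_of_nonneg_left (by linarith) (by linarith)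
  have h12 : Q * (6 * Q ^ 2 * δ₀ * (‖y‖ + |m|)) ≤ 1 / 2 * (‖y‖ + |m|) := by
    have : δ₀ * Q ^ 3 ≤ 1 / 1000 := one_div_mul_pow_le hQ (by norm_num)
    have h13 : Q * (6 * Q ^ 2 * δ₀) ≤ 1 / 2 := by linarith
    rw [← mul_assoc]
    exact mul_le_mul_of_nonneg_right h13 (by positivity)
  linarith

/-- Algebraic content of the differentiated Rankine-Hugoniot relation `(Df(u) - σ) p = q w`, with
`p` the tangent vector of the Hugoniot curve and `q` its parameter times the derivative of the
speed. Up to `O(|λ_i(u) - σ|)` the tangent is along `r_i(u)`, and `q` is comparable with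
`λ_i(u) - σ`. -/
theorem tangent_estimate {u₀ u w p : State n} {σ q : ℝ} (hu₀ : u₀ ∈ B) (hu : u ∈ B)
    (hw : ‖w - r i ubar‖ + |σ - lam i ubar| ≤ 4 * Q ^ 2 * δ₀) (hlw : leftForm r i u₀ w = 1)
    (hp : fderiv ℝ f u p - σ • p = q • w) (hlp : leftForm r i u₀ p = 1) :
    (∃ a ∈ Icc (1 / 2 : ℝ) 2, q = a * (lam i u - σ)) ∧
      ‖p - leftForm r i u p • r i u‖ ≤ 12 * Q ^ 2 * |lam i u - σ| ∧
      -(12 * Q ^ 3 * |lam i u - σ|) ≤ fderiv ℝ (lam i) u p := by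
  have hQ := h.one_le
  have hQ0 : 0 < Q := by linarith
  have hε := h.eps_pos
  have hc := h.center_mem
  have hr := h.norm_eigenvector_le
  have e1 : δ₀ * Q ^ 1 ≤ 1 / 1000 := one_div_mul_pow_le hQ (by norm_num)
  have e2 : δ₀ * Q ^ 2 ≤ 1 / 1000 := one_div_mul_pow_le hQ (by norm_num)
  have e4 : δ₀ * Q ^ 4 ≤ 1 / 1000 := one_div_mul_pow_le hQ (by norm_num)
  have e5 : δ₀ * Q ^ 5 ≤ 1 / 1000 := one_div_mul_pow_le hQ (by norm_num)
  have e0 := h.eps_le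
  obtain ⟨k1, k2⟩ := h.linearized_bounded_below hu₀ hu hw p q
  rw [hp, sub_self, norm_zero, hlp, abs_one, zero_add, mul_one] at k2
  rw [hp, sub_self, sub_zero] at k1
  -- `p` is close to `r_i(ubar)`
  have k3 := h.bounded_below (p - r i ubar) q
  have k4 : fderiv ℝ f ubar (p - r i ubar) - lam i ubar • (p - r i ubar) - q • r i ubar =
      fderiv ℝ f ubar p - lam i ubar • p - q • r i ubar := by
    rw [map_sub, h.eigen ubar hc]
    module
  rw [k4, map_sub, h.leftForm_self ubar hc, ← hlp] at k3
  have k5 : ‖p - r i ubar‖ + |q| ≤ 12 * (δ₀ * Q ^ 4) := by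
    refine k3.trans ((mul_le_mul_of_nonneg_left k1 hQ0.le).trans ?_)
    have : 6 * Q ^ 2 * δ₀ * (‖p‖ + |q|) ≤ 6 * Q ^ 2 * δ₀ * (2 * Q) :=
      mul_le_mul_of_nonneg_left k2 (by positivity)
    have := mul_le_mul_of_nonneg_left this hQ0.le
    linarith
  have k6 : ‖p - r i ubar‖ ≤ 12 * (δ₀ * Q ^ 4) := by linarith [abs_nonneg q]
  have hpn : ‖p‖ ≤ 2 * Q := by linarith [abs_nonneg q]
  -- `ℓ_i(u) p` and `ℓ_i(u) w` are close to `1`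
  have k7 : |leftForm r i u p - 1| ≤ 1 / 4 := by
    have t1 := h.abs_leftForm_sub_le hu p
    have t2 : |leftForm r i ubar (p - r i ubar)| ≤ Q * ‖p - r i ubar‖ :=
      ((leftForm r i ubar).le_opNorm _).trans
        (mul_le_mul_of_nonneg_right h.norm_leftForm_le (norm_nonneg _))
    rw [map_sub, h.leftForm_self ubar hc] at t2
    have t3 : Q * ‖p - r i ubar‖ ≤ Q * (12 * (δ₀ * Q ^ 4)) := mul_le_mul_of_nonneg_left k6 hQ0.le
    have t4 : δ₀ * ‖p‖ ≤ δ₀ * (2 * Q) := mul_le_mul_of_nonneg_left hpn hε.le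
    have t5 := abs_sub_le (leftForm r i u p) (leftForm r i ubar p) 1
    linarith
  have hwn : ‖w‖ ≤ 2 * Q := by
    have t1 := norm_add_le (w - r i ubar) (r i ubar)
    rw [sub_add_cancel] at t1
    linarith [abs_nonneg (σ - lam i ubar)]
  have k8 : |leftForm r i u w - 1| ≤ 1 / 4 := by
    have t1 := h.abs_leftForm_sub_le hu w
    have t2 := h.abs_leftForm_sub_le hu₀ w
    rw [hlw, abs_sub_comm] at t2
    have t4 : δ₀ * ‖w‖ ≤ δ₀ * (2 * Q) := mul_le_mul_of_nonneg_left hwn hε.le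
    have t5 := abs_sub_le (leftForm r i u w) (leftForm r i ubar w) 1
    linarith
  rw [abs_le] at k7 k8
  have hlw0 : 0 < leftForm r i u w := by linarith
  -- the component along `r_i(u)` of the relation
  have k9 : leftForm r i u p * (lam i u - σ) = q * leftForm r i u w := by
    have := congrArg (leftForm r i u) hp
    rw [map_sub, h.leftForm_fderiv u hu, map_smul, map_smul, smul_eq_mul, smul_eq_mul] at this
    linarith
  obtain ⟨a, ha⟩ : ∃ a, a = leftForm r i u p / leftForm r i u w := ⟨_, rfl⟩
  have ha1 : 1 / 2 ≤ a := by
    rw [ha, le_div_iff₀ hlw0]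
    linarith
  have ha2 : a ≤ 2 := by
    rw [ha, div_le_iff₀ hlw0]
    linarith
  have hq : q = a * (lam i u - σ) := by
    rw [ha, div_mul_eq_mul_div, k9, mul_div_assoc, div_self hlw0.ne', mul_one]
  -- the transversal component
  obtain ⟨y, hy⟩ : ∃ y, y = p - leftForm r i u p • r i u := ⟨_, rfl⟩
  have hly : leftForm r i u y = 0 := by
    rw [hy, map_sub, map_smul, h.leftForm_self u hu]
    simp
  have hDy : fderiv ℝ f u y - lam i u • y = (lam i u - σ) • (a • w - p) := by
    have t1 : fderiv ℝ f u p = σ • p + q • w := by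
      rw [← hp]
      abel
    rw [hy, map_sub, map_smul, h.eigen u hu, t1, hq]
    module
  have m1 : ‖(lam i u - σ) • (a • w - p)‖ ≤ |lam i u - σ| * (6 * Q) := by
    rw [norm_smul]
    refine mul_le_mul_of_nonneg_left ?_ (abs_nonneg _)
    refine (norm_sub_le _ _).trans ?_
    rw [norm_smul, Real.norm_of_nonneg (by linarith)]
    have := mul_le_mul ha2 hwn (norm_nonneg _) (by norm_num)
    linarith
  have m2 := h.bounded_below y 0
  rw [abs_zero, add_zero, zero_smul, sub_zero] at m2
  have m3 : fderiv ℝ f ubar y - lam i ubar • y = (lam i u - σ) • (a • w - p) -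
      (fderiv ℝ f u - fderiv ℝ f ubar) y + (lam i u - lam i ubar) • y := by
    rw [← hDy, sub_apply]
    module
  have m4 : ‖fderiv ℝ f ubar y - lam i ubar • y‖ ≤
      |lam i u - σ| * (6 * Q) + δ₀ * ‖y‖ + δ₀ * ‖y‖ := by
    rw [m3]
    refine (norm_add_le _ _).trans (add_le_add ((norm_sub_le _ _).trans (add_le_add m1 ?_)) ?_)
    · exact ((fderiv ℝ f u - fderiv ℝ f ubar).le_opNorm y).trans
        (mul_le_mul_of_nonneg_right (h.fderiv_sub_le u hu) (norm_nonneg _))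
    · rw [norm_smul]
      exact mul_le_mul_of_nonneg_right (h.eigenvalue_sub_le u hu) (norm_nonneg _)
  have m5 : |leftForm r i ubar y| ≤ δ₀ * ‖y‖ := by
    have := h.abs_leftForm_sub_le hu y
    rwa [hly, zero_sub, abs_neg] at this
  have m6 : ‖y‖ ≤ 12 * Q ^ 2 * |lam i u - σ| := by
    have t1 := mul_le_mul_of_nonneg_left (add_le_add m4 m5) hQ0.le
    have t2 : δ₀ * Q ^ 1 * ‖y‖ ≤ 1 / 1000 * ‖y‖ := mul_le_mul_of_nonneg_right e1 (norm_nonneg y)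
    have t3 := norm_nonneg y
    nlinarith
  refine ⟨⟨a, ⟨ha1, ha2⟩, hq⟩, hy ▸ m6, ?_⟩
  have hpy : p = leftForm r i u p • r i u + y := by
    rw [hy]
    abel
  have d1 : fderiv ℝ (lam i) u p =
      leftForm r i u p * fderiv ℝ (lam i) u (r i u) + fderiv ℝ (lam i) u y := by
    conv_lhs => rw [hpy]
    rw [map_add, map_smul, smul_eq_mul]
  have d2 : 0 ≤ leftForm r i u p * fderiv ℝ (lam i) u (r i u) :=
    mul_nonneg (by linarith) (h.mono u hu)
  have d3 : |fderiv ℝ (lam i) u y| ≤ Q * (12 * Q ^ 2 * |lam i u - σ|) :=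
    ((fderiv ℝ (lam i) u).le_opNorm y).trans
      (mul_le_mul (h.norm_fderiv_eigenvalue_le u hu) m6 (norm_nonneg _) hQ0.le)
  have d4 := neg_abs_le (fderiv ℝ (lam i) u y)
  linarith

end IsControlBall
end ConservationLaw

/-! ### Existence and uniqueness of Hugoniot curves -/

namespace ConservationLaw

theorem mem_uIcc_zero_iff {s t : ℝ} : t ∈ uIcc 0 s ↔ ∃ x ∈ Icc (0 : ℝ) 1, t = s * x := by
  rw [← segment_eq_uIcc, segment_eq_image]
  simp only [mem_image, smul_eq_mul, mul_zero, zero_add]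
  exact ⟨fun ⟨x, hx, e⟩ => ⟨x, hx, by rw [← e, mul_comm]⟩,
    fun ⟨x, hx, e⟩ => ⟨x, hx, by rw [e, mul_comm]⟩⟩

theorem uIcc_zero_subset {s t : ℝ} (ht : t ∈ uIcc 0 s) : uIcc 0 t ⊆ uIcc 0 s :=
  uIcc_subset_uIcc_left ht

/-- First exit argument: a continuous function which starts below the level `b`, and which lies
below `b` at each time up to which it has not exceeded `b`, always lies below `b`. -/
theorem forall_lt_of_forall_le {g : ℝ → ℝ} {s b : ℝ} (hg : ContinuousOn g (uIcc 0 s))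
    (h0 : g 0 < b) (h : ∀ t ∈ uIcc 0 s, (∀ τ ∈ uIcc 0 t, g τ ≤ b) → g t < b) :
    ∀ t ∈ uIcc 0 s, g t < b := by
  have hmap : MapsTo (fun x => s * x) (Icc (0 : ℝ) 1) (uIcc 0 s) :=
    fun x hx => mem_uIcc_zero_iff.2 ⟨x, hx, rfl⟩
  have hk : ContinuousOn (fun x => g (s * x)) (Icc (0 : ℝ) 1) :=
    hg.comp (by fun_prop) hmap
  by_contra! hcon
  obtain ⟨t, ht, htb⟩ := hcon
  obtain ⟨x, hx, rfl⟩ := mem_uIcc_zero_iff.1 ht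
  have hcl : IsCompact (Icc (0 : ℝ) 1 ∩ (fun x => g (s * x)) ⁻¹' Ici b) :=
    isCompact_Icc.of_isClosed_subset (hk.preimage_isClosed_of_isClosed isClosed_Icc isClosed_Ici)
      inter_subset_left
  obtain ⟨y, ⟨hy, hyb⟩, hmin⟩ := hcl.exists_isLeast ⟨x, hx, htb⟩
  have hlt : ∀ z ∈ Icc (0 : ℝ) 1, z < y → g (s * z) < b := fun z hz hzy => by
    by_contra! hz'
    exact absurd (hmin ⟨hz, hz'⟩) (not_le.2 hzy)
  have hyle : g (s * y) ≤ b := by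
    by_contra! hgt
    have hI : Icc 0 y ⊆ Icc (0 : ℝ) 1 := Icc_subset_Icc_right hy.2
    obtain ⟨z, hz, hzb⟩ := intermediate_value_Icc hy.1 (hk.mono hI)
      (⟨by simpa using h0.le, hgt.le⟩ : b ∈ Icc (g (s * 0)) (g (s * y)))
    have hzy : z < y := lt_of_le_of_ne hz.2 fun e => by
      subst e
      simp only at hzb
      linarith
    have := hlt z (hI hz) hzy
    simp only at hzb
    linarith
  have := h (s * y) (hmap hy) fun τ hτ => by
    obtain ⟨x', hx', rfl⟩ := mem_uIcc_zero_iff.1 hτ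
    rw [mul_assoc]
    rcases eq_or_lt_of_le (mul_le_of_le_one_right hy.1 hx'.2) with e | e
    · rw [e]
      exact hyle
    · exact (hlt _ ⟨mul_nonneg hy.1 hx'.1, e.le.trans hy.2⟩ e).le
  exact absurd hyb (not_le.2 this)

variable {n : ℕ} {f : State n → State n} {lam : Fin n → State n → ℝ}
  {r : Fin n → State n → State n} {i : Fin n} {U V : Set (State n)} {u₀ : State n} {I J : Set ℝ}
  {H : ℝ → State n} {σ : ℝ → ℝ}

theorem IsHugoniotCurve.mono (hC : IsHugoniotCurve f lam r i U u₀ I H σ) (hJ : J ⊆ I)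
    (hV : ∀ s ∈ J, H s ∈ V) : IsHugoniotCurve f lam r i V u₀ J H σ where
  start := hC.start
  speed_start := hC.speed_start
  continuousOn := hC.continuousOn.mono hJ
  continuousOn_speed := hC.continuousOn_speed.mono hJ
  mem := hV
  rankineHugoniot := fun s hs => hC.rankineHugoniot s (hJ hs)
  param := fun s hs => hC.param s (hJ hs)

theorem IsHugoniotCurve.rankineHugoniotMap_eq (hC : IsHugoniotCurve f lam r i U u₀ I H σ) {τ : ℝ}
    (hτ : τ ∈ I) (h0 : τ ≠ 0) :
    rankineHugoniotMap f r i u₀ τ (τ⁻¹ • (H τ - u₀), σ τ) = (0, 1) := by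
  rw [rankineHugoniotMap_eq_iff h0, smul_inv_smul₀ h0, add_sub_cancel]
  refine ⟨hC.rankineHugoniot τ hτ, ?_⟩
  rw [map_smul, leftForm_apply, hC.param τ hτ, smul_eq_mul, inv_mul_cancel₀ h0]

namespace IsControlBall
variable {ubar : State n} {Q ρ : ℝ} (h : IsControlBall f lam r i ubar Q ρ)
include h

local notation "B" => Metric.closedBall ubar ρ
local notation "δ₀" => 1 / (1000 * Q ^ 5)

/-- The a priori estimate holds all along a Hugoniot curve, since the speed cannot leave the range
in which it applies. -/
theorem hugoniotCurve_estimate {s : ℝ} (hC : IsHugoniotCurve f lam r i B u₀ (uIcc 0 s) H σ)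
    {τ : ℝ} (hτ : τ ∈ uIcc 0 s) (h0 : τ ≠ 0) :
    ‖τ⁻¹ • (H τ - u₀) - r i ubar‖ + |σ τ - lam i ubar| ≤ 4 * Q ^ 2 * δ₀ := by
  have hQ := h.one_le
  have hu₀ : u₀ ∈ B := hC.start ▸ hC.mem 0 left_mem_uIcc
  have key : ∀ τ ∈ uIcc 0 s, τ ≠ 0 → |σ τ - lam i ubar| ≤ 1 / (4 * Q) →
      ‖τ⁻¹ • (H τ - u₀) - r i ubar‖ + |σ τ - lam i ubar| ≤ 4 * Q ^ 2 * δ₀ := fun τ hτ h0 hσ => by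
    refine h.rankineHugoniot_estimate hu₀ h0 ?_ (hC.rankineHugoniotMap_eq hτ h0) hσ
    rw [smul_inv_smul₀ h0, add_sub_cancel]
    exact hC.mem τ hτ
  have hlt : 1 / (16 * Q) < 1 / (4 * Q) :=
    one_div_lt_one_div_of_lt (by positivity) (by linarith)
  have hstart : |σ 0 - lam i ubar| < 1 / (4 * Q) := by
    rw [hC.speed_start]
    refine (h.eigenvalue_sub_le u₀ hu₀).trans_lt ?_
    have h1 : δ₀ * Q ^ 1 ≤ 1 / 1000 := one_div_mul_pow_le hQ (by norm_num)
    rw [lt_div_iff₀ (by positivity)]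
    linarith
  refine key τ hτ h0 (forall_lt_of_forall_le (g := fun τ => |σ τ - lam i ubar|)
    ((hC.continuousOn_speed.sub continuousOn_const).abs) hstart (fun t ht hle => ?_) τ hτ).le
  by_cases ht0 : t = 0
  · rw [ht0]
    exact hstart
  · have h1 := key t ht ht0 (hle t right_mem_uIcc)
    have h2 := norm_nonneg (t⁻¹ • (H t - u₀) - r i ubar)
    linarith [h.estimate_le_radius]

theorem mem_closedBall_of_estimate {w : State n} {c : ℝ}
    (hw : ‖w - r i ubar‖ + |c - lam i ubar| ≤ 4 * Q ^ 2 * δ₀) :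
    ((w, c) : State n × ℝ) ∈ Metric.closedBall (r i ubar, lam i ubar) (1 / (16 * Q)) := by
  rw [mem_closedBall_iff_norm, Prod.mk_sub_mk]
  exact (max_le_add_of_nonneg (norm_nonneg _) (norm_nonneg _)).trans
    (hw.trans h.estimate_le_radius)

/-- Two Hugoniot curves with the same origin coincide, together with their speeds. -/
theorem hugoniotCurve_unique {s : ℝ} {H' : ℝ → State n} {σ' : ℝ → ℝ}
    (hC : IsHugoniotCurve f lam r i B u₀ (uIcc 0 s) H σ)
    (hC' : IsHugoniotCurve f lam r i B u₀ (uIcc 0 s) H' σ') {τ : ℝ} (hτ : τ ∈ uIcc 0 s) :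
    H τ = H' τ ∧ σ τ = σ' τ := by
  by_cases h0 : τ = 0
  · rw [h0, hC.start, hC'.start, hC.speed_start, hC'.speed_start]
    exact ⟨rfl, rfl⟩
  have hu₀ : u₀ ∈ B := hC.start ▸ hC.mem 0 left_mem_uIcc
  have h1 := h.norm_sub_le_rankineHugoniotMap (s := τ) hu₀
    (z₁ := (τ⁻¹ • (H τ - u₀), σ τ)) (z₂ := (τ⁻¹ • (H' τ - u₀), σ' τ))
    (by simpa [smul_inv_smul₀ h0] using hC.mem τ hτ)
    (by simpa [smul_inv_smul₀ h0] using hC'.mem τ hτ)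
    (h.mem_closedBall_of_estimate (h.hugoniotCurve_estimate hC hτ h0))
    (h.mem_closedBall_of_estimate (h.hugoniotCurve_estimate hC' hτ h0))
  rw [hC.rankineHugoniotMap_eq hτ h0, hC'.rankineHugoniotMap_eq hτ h0, sub_self, norm_zero,
    mul_zero, norm_le_zero_iff, sub_eq_zero, Prod.mk.injEq] at h1
  exact ⟨sub_left_inj.1 (smul_right_injective _ (inv_ne_zero h0) h1.1), h1.2⟩

/-- A Hugoniot curve coincides with one that is known to stay in the ball. -/
theorem hugoniotCurve_eq_of_mem_ball {s : ℝ} {H' : ℝ → State n} {σ' : ℝ → ℝ}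
    (hC : IsHugoniotCurve f lam r i U u₀ (uIcc 0 s) H σ)
    (hC' : IsHugoniotCurve f lam r i (Metric.ball ubar ρ) u₀ (uIcc 0 s) H' σ')
    {τ : ℝ} (hτ : τ ∈ uIcc 0 s) : H τ = H' τ ∧ σ τ = σ' τ := by
  have hsub : ∀ t ∈ uIcc 0 s, (∀ τ ∈ uIcc 0 t, dist (H τ) ubar ≤ ρ) →
      H t = H' t ∧ σ t = σ' t := fun t ht hle =>
    h.hugoniotCurve_unique (hC.mono (uIcc_zero_subset ht) hle)
      (hC'.mono (uIcc_zero_subset ht) fun τ hτ =>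
        Metric.ball_subset_closedBall (hC'.mem τ (uIcc_zero_subset ht hτ))) right_mem_uIcc
  have hlt := forall_lt_of_forall_le (g := fun τ => dist (H τ) ubar) (b := ρ)
    ((continuous_id.dist continuous_const).comp_continuousOn hC.continuousOn)
    (by
      have := hC'.mem 0 left_mem_uIcc
      rw [hC'.start] at this
      simpa only [hC.start, Metric.mem_ball] using this)
    (fun t ht hle => by
      simp only [(hsub t ht hle).1]
      exact hC'.mem t ht)
  exact hsub τ hτ fun t ht => (hlt t (uIcc_zero_subset hτ ht)).le

theorem continuousAt_rankineHugoniotMap (hu₀ : u₀ ∈ B) {z : State n × ℝ} {s : ℝ}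
    (hs : u₀ + s • z.1 ∈ B) :
    ContinuousAt (fun s => rankineHugoniotMap f r i u₀ s z) s := by
  have hcont : ContinuousAt
      (fun s : ℝ => if s = 0 then fderiv ℝ f u₀ z.1 else s⁻¹ • (f (u₀ + s • z.1) - f u₀)) s := by
    by_cases h0 : s = 0
    · subst h0
      have hline : HasDerivAt (fun s : ℝ => u₀ + s • z.1) z.1 0 := by
        simpa using ((hasDerivAt_id (0 : ℝ)).smul_const z.1).const_add u₀
      have hd : HasDerivAt (fun s : ℝ => f (u₀ + s • z.1)) (fderiv ℝ f u₀ z.1) 0 :=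
        HasFDerivAt.comp_hasDerivAt (l := f) 0 (by simpa using h.hasFDerivAt hu₀) hline
      have := hasDerivAt_iff_tendsto_slope_zero.1 hd
      rw [continuousAt_iff_punctured_nhds]
      simp only [if_true]
      refine this.congr' ?_
      filter_upwards [self_mem_nhdsWithin] with t ht
      have ht' : t ≠ 0 := ht
      simp [ht']
    · have hf : ContinuousAt (fun s : ℝ => f (u₀ + s • z.1)) s :=
        ContinuousAt.comp (g := f) (h.contDiffAt_flux _ hs).continuousAt (by fun_prop)
      have : ContinuousAt (fun s : ℝ => s⁻¹ • (f (u₀ + s • z.1) - f u₀)) s :=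
        (continuousAt_inv₀ h0).smul (hf.sub continuousAt_const)
      refine this.congr ?_
      filter_upwards [isOpen_ne.mem_nhds h0] with t ht
      have ht' : t ≠ 0 := ht
      simp [ht']
  exact (hcont.sub continuousAt_const).prodMk continuousAt_const

/-- Existence of the Hugoniot curve, on an interval independent of its origin. -/
theorem exists_hugoniotCurve (hu₀ : u₀ ∈ Metric.ball ubar (ρ / 2)) {s₀ : ℝ} (hs₀ : 0 ≤ s₀)
    (hs₀ρ : s₀ * (4 * Q) ≤ ρ) :
    ∃ H σ, IsHugoniotCurve f lam r i (Metric.ball ubar ρ) u₀ (Icc (-s₀) s₀) H σ := by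
  have hQ := h.one_le
  have hρ := h.pos
  have hu₀B : u₀ ∈ B := by
    rw [Metric.mem_ball] at hu₀
    rw [Metric.mem_closedBall]
    linarith
  have hmem : ∀ s ∈ Icc (-s₀) s₀,
      ∀ z ∈ Metric.closedBall (r i ubar, lam i ubar) (1 / (16 * Q)),
        u₀ + s • z.1 ∈ Metric.ball ubar ρ := by
    intro s hs z hz
    have h1 : ‖z.1 - r i ubar‖ ≤ 1 / (16 * Q) := by
      rw [mem_closedBall_iff_norm] at hz
      exact (norm_fst_le (z - (r i ubar, lam i ubar))).trans hz
    have h2 : 1 / (16 * Q) ≤ 1 := by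
      rw [div_le_one (by positivity)]
      linarith
    have h3 := norm_add_le (z.1 - r i ubar) (r i ubar)
    rw [sub_add_cancel] at h3
    have h4 : ‖z.1‖ ≤ 2 * Q := by linarith [h.norm_eigenvector_le]
    have h5 : ‖s • z.1‖ ≤ s₀ * (2 * Q) := by
      rw [norm_smul]
      exact mul_le_mul (abs_le.2 hs) h4 (norm_nonneg _) hs₀
    rw [mem_ball_iff_norm] at hu₀ ⊢
    have h6 := norm_add_le (u₀ - ubar) (s • z.1)
    rw [add_sub_right_comm]
    linarith
  choose! Z hZ hZeq using fun s (hs : s ∈ Icc (-s₀) s₀) =>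
    h.exists_rankineHugoniotMap_eq hu₀B fun z hz => Metric.ball_subset_closedBall (hmem s hs z hz)
  have h0 : (0 : ℝ) ∈ Icc (-s₀) s₀ := ⟨by linarith, hs₀⟩
  -- `Z s` is any choice of solution; it is continuous by the uniform bound for the inverse
  have hcont : ContinuousOn Z (Icc (-s₀) s₀) := by
    intro s hs
    have hin : ∀ t ∈ Icc (-s₀) s₀, ∀ z ∈ Metric.closedBall (r i ubar, lam i ubar) (1 / (16 * Q)),
        u₀ + t • z.1 ∈ B := fun t ht z hz => Metric.ball_subset_closedBall (hmem t ht z hz)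
    have hc : ContinuousAt (fun t => 4 * Q * ‖rankineHugoniotMap f r i u₀ s (Z s) -
        rankineHugoniotMap f r i u₀ t (Z s)‖) s :=
      continuousAt_const.mul (continuousAt_const.sub
        (h.continuousAt_rankineHugoniotMap hu₀B (hin s hs _ (hZ s hs)))).norm
    have hc' := hc.tendsto
    rw [sub_self, norm_zero, mul_zero] at hc'
    refine tendsto_iff_norm_sub_tendsto_zero.2 (squeeze_zero' (Eventually.of_forall fun t =>
      norm_nonneg _) ?_ (hc'.mono_left nhdsWithin_le_nhds))
    filter_upwards [self_mem_nhdsWithin] with t ht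
    have := h.norm_sub_le_rankineHugoniotMap hu₀B (hin t ht _ (hZ t ht)) (hin t ht _ (hZ s hs))
      (hZ t ht) (hZ s hs)
    rwa [hZeq t ht, ← hZeq s hs] at this
  refine ⟨fun s => u₀ + s • (Z s).1, fun s => (Z s).2, ?_⟩
  exact
    { start := by simp
      speed_start := by
        have h1 := hZeq 0 h0
        rw [rankineHugoniotMap, if_pos rfl, Prod.mk.injEq] at h1
        have h2 := congrArg (leftForm r i u₀) h1.1
        rw [map_sub, h.leftForm_fderiv u₀ hu₀B, map_smul, h1.2, map_zero] at h2
        simp only [smul_eq_mul] at h2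
        linarith
      continuousOn := continuousOn_const.add
        (continuousOn_id.smul (continuous_fst.comp_continuousOn hcont))
      continuousOn_speed := continuous_snd.comp_continuousOn hcont
      mem := fun s hs => hmem s hs _ (hZ s hs)
      rankineHugoniot := fun s hs => by
        by_cases hs0 : s = 0
        · simp [hs0]
        · rw [add_sub_cancel_left]
          exact ((rankineHugoniotMap_eq_iff hs0).1 (hZeq s hs)).1
      param := fun s hs => by
        have h1 := congrArg Prod.snd (hZeq s hs)
        simp only [rankineHugoniotMap] at h1
        rw [add_sub_cancel_left, ← leftForm_apply, map_smul, h1, smul_eq_mul, mul_one] }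

end IsControlBall
end ConservationLaw

/-! ### The sign of the gap between characteristic and shock speeds -/

namespace ConservationLaw

/-- The singular differential inequality behind the sign of `λ_i - σ` along a Hugoniot curve:
`ψ' ≥ -C |ψ| - a ψ / t` with `a` bounded away from `0`, where `χ' = a ψ / t`. A negative `ψ` would
be nondecreasing, hence `ψ ≥ 0`; and `t³ ψ` is nondecreasing, hence a zero of `ψ` propagates
back to `0`. -/
theorem nonneg_of_singular_ineq {ψ χ : ℝ → ℝ} {T C : ℝ} (hT : 0 ≤ T) (hC : 0 ≤ C)
    (hCT : C * T ≤ 1 / 2) (hψ : ContinuousOn ψ (Icc 0 T)) (hχ : ContinuousOn χ (Icc 0 T))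
    (hψ0 : ψ 0 = 0)
    (hd : ∀ t ∈ Ioo 0 T, ∃ a ∈ Icc (1 / 2 : ℝ) 2, ∃ ψ', HasDerivAt ψ ψ' t ∧
      HasDerivAt χ (a * ψ t / t) t ∧ -(C * |ψ t|) - a * ψ t / t ≤ ψ') :
    (∀ t ∈ Icc 0 T, 0 ≤ ψ t) ∧ MonotoneOn χ (Icc 0 T) ∧
      (ψ T = 0 ∨ χ T = χ 0 → ∀ t ∈ Icc 0 T, ψ t = 0 ∧ χ t = χ 0) := by
  have hpos : ∀ t ∈ Icc 0 T, 0 ≤ ψ t := by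
    intro t₁ ht₁
    by_contra! hneg
    have hI : Icc 0 t₁ ⊆ Icc 0 T := Icc_subset_Icc_right ht₁.2
    obtain ⟨t₀, ⟨ht₀, hψt₀⟩, hmax⟩ := (isCompact_Icc.of_isClosed_subset
      ((hψ.mono hI).preimage_isClosed_of_isClosed isClosed_Icc isClosed_Ici)
      inter_subset_left).exists_isGreatest ⟨0, ⟨le_rfl, ht₁.1⟩, hψ0.ge⟩
    have hlt : ∀ t ∈ Ioo t₀ t₁, ψ t < 0 := fun t ht => by
      by_contra! h
      exact absurd (hmax ⟨⟨ht₀.1.trans ht.1.le, ht.2.le⟩, h⟩) (not_le.2 ht.1)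
    have hder : ∀ t ∈ Ioo t₀ t₁, ∃ ψ', HasDerivAt ψ ψ' t ∧ 0 ≤ ψ' := fun t ht => by
      have ht0 : 0 < t := ht₀.1.trans_lt ht.1
      have htT : t < T := ht.2.trans_le ht₁.2
      obtain ⟨a, ha, ψ', h1, -, h3⟩ := hd t ⟨ht0, htT⟩
      refine ⟨ψ', h1, h3.trans' ?_⟩
      have hψt := hlt t ht
      rw [abs_of_neg hψt]
      have hCa : C * t ≤ a := (mul_le_mul_of_nonneg_left htT.le hC).trans (hCT.trans ha.1)
      have : -(C * -ψ t) - a * ψ t / t = -ψ t * ((a - C * t) / t) := by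
        field_simp
        ring
      rw [this]
      exact mul_nonneg (by linarith) (div_nonneg (by linarith) ht0.le)
    have hmono : MonotoneOn ψ (Icc t₀ t₁) := by
      refine monotoneOn_of_deriv_nonneg (convex_Icc _ _)
        (hψ.mono (Icc_subset_Icc ht₀.1 ht₁.2)) ?_ ?_ <;> rw [interior_Icc] <;> intro t ht <;>
        obtain ⟨ψ', h1, h2⟩ := hder t ht
      · exact h1.differentiableAt.differentiableWithinAt
      · rwa [h1.deriv]
    have := hmono ⟨le_rfl, ht₀.2⟩ ⟨ht₀.2, le_rfl⟩ ht₀.2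
    have h0 : 0 ≤ ψ t₀ := hψt₀
    linarith
  have hχmono : MonotoneOn χ (Icc 0 T) := by
    refine monotoneOn_of_deriv_nonneg (convex_Icc _ _) hχ ?_ ?_ <;> rw [interior_Icc] <;>
      intro t ht <;> obtain ⟨a, ha, ψ', -, h2, -⟩ := hd t ht
    · exact h2.differentiableAt.differentiableWithinAt
    · rw [h2.deriv]
      exact div_nonneg (mul_nonneg (by linarith [ha.1]) (hpos t (Ioo_subset_Icc_self ht))) ht.1.le
  refine ⟨hpos, hχmono, fun hor => ?_⟩
  rcases hT.eq_or_lt with rfl | hT0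
  · intro t ht
    obtain rfl : t = 0 := le_antisymm ht.2 ht.1
    exact ⟨hψ0, rfl⟩
  have h0T : (0 : ℝ) ∈ Icc 0 T := ⟨le_rfl, hT⟩
  have hTT : T ∈ Icc 0 T := ⟨hT, le_rfl⟩
  rcases hor with hor | hor
  · have hcube : MonotoneOn (fun t => t ^ 3 * ψ t) (Icc 0 T) := by
      refine monotoneOn_of_deriv_nonneg (convex_Icc _ _) (by fun_prop) ?_ ?_ <;>
        rw [interior_Icc] <;> intro t ht <;> obtain ⟨a, ha, ψ', h1, -, h3⟩ := hd t ht
      · exact ((hasDerivAt_pow 3 t).mul h1).differentiableAt.differentiableWithinAt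
      · have h4 := ((hasDerivAt_pow 3 t).mul h1).deriv
        have h5 : (fun t => t ^ 3 * ψ t) = (fun t => t ^ 3) * ψ := rfl
        rw [h5, h4]
        have hψt := hpos t (Ioo_subset_Icc_self ht)
        rw [abs_of_nonneg hψt] at h3
        have h6 := mul_le_mul_of_nonneg_left h3 (pow_nonneg ht.1.le 3)
        have ht0 : 0 < t := ht.1
        have h7 : t ^ 3 * (-(C * ψ t) - a * ψ t / t) = -(t ^ 2 * ψ t) * (C * t + a) := by
          field_simp
          ring
        have hCt : C * t ≤ 1 / 2 := (mul_le_mul_of_nonneg_left ht.2.le hC).trans hCT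
        have h8 : t ^ 2 * ψ t * (C * t + a) ≤ t ^ 2 * ψ t * 3 :=
          mul_le_mul_of_nonneg_left (by linarith [ha.2]) (mul_nonneg (sq_nonneg t) hψt)
        norm_num
        linarith
    have hzero : ∀ t ∈ Icc 0 T, ψ t = 0 := fun t ht => by
      rcases ht.1.eq_or_lt with rfl | ht0
      · exact hψ0
      have h1 := hcube ht hTT ht.2
      simp only [hor, mul_zero] at h1
      have h2 := hpos t ht
      have h3 : 0 < t ^ 3 := by positivity
      exact le_antisymm (by nlinarith) h2
    have hanti : AntitoneOn χ (Icc 0 T) := by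
      refine antitoneOn_of_deriv_nonpos (convex_Icc _ _) hχ ?_ ?_ <;> rw [interior_Icc] <;>
        intro t ht <;> obtain ⟨a, ha, ψ', -, h2, -⟩ := hd t ht
      · exact h2.differentiableAt.differentiableWithinAt
      · rw [h2.deriv, hzero t (Ioo_subset_Icc_self ht)]
        simp
    exact fun t ht => ⟨hzero t ht, le_antisymm (hanti h0T ht ht.1) (hχmono h0T ht ht.1)⟩
  · have hconst : ∀ t ∈ Icc 0 T, χ t = χ 0 := fun t ht =>
      le_antisymm (hor ▸ hχmono ht hTT ht.2) (hχmono h0T ht ht.1)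
    have hzero : EqOn ψ (fun _ => 0) (Ioo 0 T) := fun t ht => by
      obtain ⟨a, ha, ψ', -, h2, -⟩ := hd t ht
      have h3 : HasDerivAt χ 0 t := (hasDerivAt_const t (χ 0)).congr_of_eventuallyEq <| by
        filter_upwards [Ioo_mem_nhds ht.1 ht.2] with x hx
        exact hconst x (Ioo_subset_Icc_self hx)
      have h4 := h2.unique h3
      have ha0 : a ≠ 0 := by linarith [ha.1]
      simpa [ha0, ht.1.ne'] using h4
    have hzero' := hzero.of_subset_closure hψ continuousOn_const Ioo_subset_Icc_self
      (closure_Ioo hT0.ne).ge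
    exact fun t ht => ⟨hzero' ht, hconst t ht⟩

/-- A continuous curve whose image under a local diffeomorphism is differentiable is
differentiable. -/
theorem hasDerivAt_of_comp {E F : Type*} [NormedAddCommGroup E] [NormedSpace ℝ E] [CompleteSpace E]
    [NormedAddCommGroup F] [NormedSpace ℝ F] {g : E → F} {g' : E ≃L[ℝ] F} {z : ℝ → E} {q : F}
    {t : ℝ} (hg : HasStrictFDerivAt g (g' : E →L[ℝ] F) (z t)) (hz : ContinuousAt z t)
    (hq : HasDerivAt (fun τ => g (z τ)) q t) : HasDerivAt z (g'.symm q) t := by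
  have h1 := hg.to_localInverse.hasFDerivAt.comp_hasDerivAt t hq
  refine h1.congr_of_eventuallyEq ?_
  filter_upwards [hz.eventually hg.eventually_left_inverse] with τ hτ
  exact hτ.symm

variable {n : ℕ} {f : State n → State n} {lam : Fin n → State n → ℝ}
  {r : Fin n → State n → State n} {i : Fin n} {u₀ : State n}
  {H : ℝ → State n} {σ : ℝ → ℝ}

namespace IsControlBall
variable {ubar : State n} {Q ρ : ℝ} (h : IsControlBall f lam r i ubar Q ρ)
include h

local notation "B" => Metric.closedBall ubar ρ
local notation "δ₀" => 1 / (1000 * Q ^ 5)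

/-- Away from its origin a Hugoniot curve is differentiable, with a differentiable speed. -/
theorem hugoniotCurve_hasDerivAt {s τ : ℝ} (hC : IsHugoniotCurve f lam r i B u₀ (uIcc 0 s) H σ)
    (hτ : uIcc 0 s ∈ 𝓝 τ) (h0 : τ ≠ 0) :
    ∃ p d, HasDerivAt H p τ ∧ HasDerivAt σ d τ ∧
      fderiv ℝ f (H τ) p - σ τ • p = d • (H τ - u₀) ∧ leftForm r i u₀ p = 1 := by
  have hmem : τ ∈ uIcc 0 s := mem_of_mem_nhds hτ
  have hu₀ : u₀ ∈ B := hC.start ▸ hC.mem 0 left_mem_uIcc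
  have hH := hC.mem τ hmem
  have hest := h.hugoniotCurve_estimate hC hmem h0
  -- `t ↦ (H t, σ t)` solves `g (H t, σ t) = (0, t)`, and `g` is a local diffeomorphism there
  let g : State n × ℝ → State n × ℝ :=
    fun z => (f z.1 - f u₀ - z.2 • (z.1 - u₀), leftForm r i u₀ (z.1 - u₀))
  let g' : State n × ℝ →L[ℝ] State n × ℝ :=
    ((fderiv ℝ f (H τ)).comp (ContinuousLinearMap.fst ℝ (State n) ℝ) -
      (σ τ • ContinuousLinearMap.fst ℝ (State n) ℝ +
        (ContinuousLinearMap.snd ℝ (State n) ℝ).smulRight (H τ - u₀))).prod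
    ((leftForm r i u₀).comp (ContinuousLinearMap.fst ℝ (State n) ℝ))
  have hg'_apply : ∀ z, g' z = (fderiv ℝ f (H τ) z.1 - (σ τ • z.1 + z.2 • (H τ - u₀)),
      leftForm r i u₀ z.1) := fun z => rfl
  have hg : HasStrictFDerivAt g g' (H τ, σ τ) := by
    have hfst : HasStrictFDerivAt (fun z : State n × ℝ => z.1)
        (ContinuousLinearMap.fst ℝ (State n) ℝ) (H τ, σ τ) := hasStrictFDerivAt_fst
    have hsnd : HasStrictFDerivAt (fun z : State n × ℝ => z.2)
        (ContinuousLinearMap.snd ℝ (State n) ℝ) (H τ, σ τ) := hasStrictFDerivAt_snd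
    have hf : HasStrictFDerivAt f (fderiv ℝ f (H τ)) (H τ, σ τ).1 :=
      (h.contDiffAt_flux _ hH).hasStrictFDerivAt (by norm_num)
    exact (((hf.comp _ hfst).sub_const (f u₀)).sub (hsnd.smul (hfst.sub_const u₀))).prodMk
      ((leftForm r i u₀).hasStrictFDerivAt.comp _ (hfst.sub_const u₀))
  have hinj : Function.Injective g' := by
    refine (injective_iff_map_eq_zero _).2 fun z hz => ?_
    rw [hg'_apply, Prod.mk_eq_zero] at hz
    have h1 := (h.linearized_bounded_below hu₀ hH hest z.1 (τ * z.2)).2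
    have h2 : fderiv ℝ f (H τ) z.1 - σ τ • z.1 - (τ * z.2) • τ⁻¹ • (H τ - u₀) = 0 := by
      rw [smul_smul, mul_right_comm, mul_inv_cancel₀ h0, one_mul, sub_sub]
      exact hz.1
    rw [h2, hz.2, norm_zero, abs_zero, add_zero, mul_zero] at h1
    have h3 := norm_nonneg z.1
    have h4 := abs_nonneg (τ * z.2)
    have h5 : z.1 = 0 := norm_eq_zero.1 (by linarith)
    have h6 : τ * z.2 = 0 := abs_eq_zero.1 (by linarith)
    exact Prod.ext h5 ((mul_eq_zero.1 h6).resolve_left h0)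
  let e : (State n × ℝ) ≃L[ℝ] State n × ℝ :=
    (LinearEquiv.ofInjectiveEndo (g' : State n × ℝ →ₗ[ℝ] State n × ℝ) hinj).toContinuousLinearEquiv
  have he : (e : State n × ℝ →L[ℝ] State n × ℝ) = g' := rfl
  have hz : ContinuousAt (fun t => (H t, σ t)) τ :=
    (hC.continuousOn.continuousAt hτ).prodMk (hC.continuousOn_speed.continuousAt hτ)
  have hq : HasDerivAt (fun t => g (H t, σ t)) ((0, 1) : State n × ℝ) τ := by
    refine ((hasDerivAt_const τ (0 : State n)).prodMk (hasDerivAt_id τ)).congr_of_eventuallyEq ?_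
    filter_upwards [hτ] with t ht
    have h1 := hC.rankineHugoniot t ht
    have h2 := hC.param t ht
    rw [← leftForm_apply] at h2
    change (f (H t) - f u₀ - σ t • (H t - u₀), leftForm r i u₀ (H t - u₀)) = (0, t)
    rw [h1, h2, sub_self]
  have hder := hasDerivAt_of_comp (g' := e) (he ▸ hg) hz hq
  obtain ⟨z', hz'⟩ : ∃ z', z' = e.symm (0, 1) := ⟨_, rfl⟩
  rw [← hz'] at hder
  have hez : g' z' = (0, 1) := by
    rw [hz']
    exact e.apply_symm_apply _
  rw [hg'_apply, Prod.mk.injEq, ← sub_sub, sub_eq_zero] at hez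
  exact ⟨z'.1, z'.2, hder.fst, hder.snd, hez⟩

/-- The gap `λ_i(H) - σ` along a Hugoniot curve has the sign `θ` of the parameter, the speed is
nondecreasing, and the gap vanishes identically as soon as it vanishes at the end point or the
speed takes the same value at both end points. -/
theorem hugoniotCurve_gap {θ T : ℝ} (hθ : θ * θ = 1) (hT : 0 ≤ T)
    (hC : IsHugoniotCurve f lam r i B u₀ (uIcc 0 (θ * T)) H σ) :
    (∀ t ∈ Icc 0 T, 0 ≤ θ * (lam i (H (θ * t)) - σ (θ * t))) ∧
      MonotoneOn (fun t => θ * σ (θ * t)) (Icc 0 T) ∧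
      (θ * (lam i (H (θ * T)) - σ (θ * T)) = 0 ∨ θ * σ (θ * T) = θ * σ (θ * 0) →
        ∀ t ∈ Icc 0 T, θ * (lam i (H (θ * t)) - σ (θ * t)) = 0 ∧
          θ * σ (θ * t) = θ * σ (θ * 0)) := by
  have hQ := h.one_le
  have hθ0 : θ ≠ 0 := fun e => by simp [e] at hθ
  have hθ1 : |θ| = 1 := by
    rcases mul_self_eq_one_iff.1 hθ with rfl | rfl <;> simp
  have hu₀ : u₀ ∈ B := hC.start ▸ hC.mem 0 left_mem_uIcc
  have hmap : MapsTo (fun t => θ * t) (Icc 0 T) (uIcc 0 (θ * T)) := fun t ht => by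
    have : t ∈ uIcc 0 T := by rwa [uIcc_of_le hT]
    obtain ⟨x, hx, rfl⟩ := mem_uIcc_zero_iff.1 this
    exact mem_uIcc_zero_iff.2 ⟨x, hx, (mul_assoc _ _ _).symm⟩
  have hcL : ContinuousOn (lam i) B := fun u hu =>
    (h.contDiffAt_eigenvalue u hu).continuousAt.continuousWithinAt
  have hcθ : ContinuousOn (fun t => θ * t) (Icc 0 T) := by fun_prop
  have hcH := hC.continuousOn.comp hcθ hmap
  have hcσ : ContinuousOn (fun t => σ (θ * t)) (Icc 0 T) := hC.continuousOn_speed.comp hcθ hmap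
  have hcLH : ContinuousOn (fun t => lam i (H (θ * t))) (Icc 0 T) :=
    hcL.comp hcH fun t ht => hC.mem _ (hmap ht)
  refine nonneg_of_singular_ineq (C := 12 * Q ^ 3) hT (by positivity) ?_
    (continuousOn_const.mul (hcLH.sub hcσ)) (continuousOn_const.mul hcσ) ?_ fun t ht => ?_
  -- the parameter is bounded by the size of the ball, which was chosen small compared with `Q⁻⁵`
  · have h1 := h.abs_leftForm_le hu₀ (H (θ * T) - u₀)
    rw [leftForm_apply, hC.param _ right_mem_uIcc, abs_mul, hθ1, one_mul, abs_of_nonneg hT] at h1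
    have h2 : ‖H (θ * T) - u₀‖ ≤ 2 * δ₀ := by
      have t1 := hC.mem _ right_mem_uIcc
      rw [mem_closedBall_iff_norm] at t1 hu₀
      have t2 := norm_sub_le_norm_sub_add_norm_sub (H (θ * T)) ubar u₀
      rw [norm_sub_rev ubar] at t2
      linarith [h.radius_le]
    have h3 : δ₀ * Q ^ 4 ≤ 1 / 1000 := one_div_mul_pow_le hQ (by norm_num)
    have h4 : T ≤ 2 * Q * (2 * δ₀) := h1.trans (mul_le_mul_of_nonneg_left h2 (by linarith))
    have h5 := mul_le_mul_of_nonneg_left h4 (by positivity : 0 ≤ 12 * Q ^ 3)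
    linarith
  · rw [mul_zero, hC.start, hC.speed_start, sub_self, mul_zero]
  · have ht0 : θ * t ≠ 0 := mul_ne_zero hθ0 ht.1.ne'
    have hnhds : uIcc 0 (θ * T) ∈ 𝓝 (θ * t) := by
      rcases mul_self_eq_one_iff.1 hθ with rfl | rfl
      · rw [one_mul, one_mul, uIcc_of_le hT]
        exact Icc_mem_nhds ht.1 ht.2
      · rw [uIcc_of_ge (by linarith)]
        exact Icc_mem_nhds (by linarith [ht.2]) (by linarith [ht.1])
    have hmem := hmap (Ioo_subset_Icc_self ht)
    obtain ⟨p, d, hp, hd, hRH, hlp⟩ := h.hugoniotCurve_hasDerivAt hC hnhds ht0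
    have hw := h.hugoniotCurve_estimate hC hmem ht0
    have hlw : leftForm r i u₀ ((θ * t)⁻¹ • (H (θ * t) - u₀)) = 1 := by
      rw [map_smul, leftForm_apply, hC.param _ hmem, smul_eq_mul, inv_mul_cancel₀ ht0]
    obtain ⟨⟨a, ha, hq⟩, -, hL⟩ := h.tangent_estimate (q := d * (θ * t)) hu₀ (hC.mem _ hmem) hw hlw
      (by rw [hRH, mul_smul, smul_inv_smul₀ ht0]) hlp
    have hθt : HasDerivAt (fun t => θ * t) θ t := by
      simpa using (hasDerivAt_id t).const_mul θ
    have d1 : HasDerivAt (fun t => σ (θ * t)) (d * θ) t := hd.comp t hθt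
    have d2 : HasDerivAt (fun t => lam i (H (θ * t))) (fderiv ℝ (lam i) (H (θ * t)) p * θ) t :=
      (((h.contDiffAt_eigenvalue _ (hC.mem _ hmem)).differentiableAt
        (by norm_num)).hasFDerivAt.comp_hasDerivAt (θ * t) hp).comp t hθt
    refine ⟨a, ha, _, (d2.sub d1).const_mul θ, ?_, ?_⟩
    · convert! d1.const_mul θ using 1
      rw [div_eq_iff ht.1.ne']
      linear_combination -θ * hq
    · have e1 : θ * (fderiv ℝ (lam i) (H (θ * t)) p * θ - d * θ) =
          fderiv ℝ (lam i) (H (θ * t)) p - d := by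
        linear_combination (fderiv ℝ (lam i) (H (θ * t)) p - d) * hθ
      have e2 : a * (θ * (lam i (H (θ * t)) - σ (θ * t))) / t = d := by
        rw [div_eq_iff ht.1.ne']
        linear_combination -θ * hq + d * t * hθ
      rw [e1, e2, abs_mul, hθ1, one_mul]
      linarith

/-- Along the branch `s ≤ 0` the speed is at least the characteristic speed of the right state, and
nondecreasing. -/
theorem hugoniotCurve_of_nonpos {s : ℝ} (hs : s ≤ 0)
    (hC : IsHugoniotCurve f lam r i B u₀ (uIcc 0 s) H σ) {τ : ℝ} (hτ : τ ∈ uIcc 0 s) :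
    lam i (H τ) ≤ σ τ ∧ σ s ≤ σ τ := by
  obtain ⟨T, rfl⟩ : ∃ T, s = -1 * T := ⟨-s, by ring⟩
  have hT : 0 ≤ T := by linarith
  obtain ⟨h1, h2, -⟩ := h.hugoniotCurve_gap (by norm_num) hT hC
  rw [uIcc_of_ge hs] at hτ
  have hτ' : -τ ∈ Icc 0 T := ⟨by linarith [hτ.2], by linarith [hτ.1]⟩
  have h3 := h1 _ hτ'
  have h4 := h2 hτ' ⟨hT, le_rfl⟩ hτ'.2
  simp only [one_mul, neg_mul, neg_neg] at h3 h4 ⊢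
  exact ⟨by linarith, by linarith⟩

/-- On the branch `s ≥ 0`, Liu's condition forces the speed to be constant. -/
theorem speed_eq_of_liu {s : ℝ} (hs : 0 ≤ s) (hC : IsHugoniotCurve f lam r i B u₀ (uIcc 0 s) H σ)
    (hliu : ∀ τ ∈ uIcc 0 s, σ s ≤ σ τ) : σ s = σ 0 := by
  rw [← one_mul s] at hC
  obtain ⟨-, h2, -⟩ := h.hugoniotCurve_gap (by norm_num) hs hC
  have h3 := h2 ⟨le_rfl, hs⟩ ⟨hs, le_rfl⟩ hs
  simp only [one_mul] at h3
  exact le_antisymm (hliu 0 left_mem_uIcc) h3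

/-- A Hugoniot curve whose end state is sonic, or whose speed returns to its initial value, is a
contact discontinuity: all its states are characteristic, with one and the same speed. -/
theorem hugoniotCurve_characteristic {s : ℝ}
    (hC : IsHugoniotCurve f lam r i B u₀ (uIcc 0 s) H σ)
    (hor : lam i (H s) = σ s ∨ σ s = σ 0) {τ : ℝ} (hτ : τ ∈ uIcc 0 s) :
    lam i (H τ) = lam i u₀ ∧ σ τ = lam i u₀ := by
  obtain ⟨θ, T, hθ, hT, rfl⟩ : ∃ θ T : ℝ, θ * θ = 1 ∧ 0 ≤ T ∧ s = θ * T := by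
    rcases le_total 0 s with hs | hs
    · exact ⟨1, s, by norm_num, hs, by ring⟩
    · exact ⟨-1, -s, by norm_num, by linarith, by ring⟩
  have hθ0 : θ ≠ 0 := fun e => by simp [e] at hθ
  have h3 := (h.hugoniotCurve_gap hθ hT hC).2.2 (by
    rcases hor with e | e
    · left; rw [e, sub_self, mul_zero]
    · right; rw [e, mul_zero])
  obtain ⟨x, hx, rfl⟩ := mem_uIcc_zero_iff.1 hτ
  obtain ⟨h4, h5⟩ := h3 (T * x) ⟨mul_nonneg hT hx.1, mul_le_of_le_one_right hT hx.2⟩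
  rw [mul_assoc]
  rw [mul_zero, hC.speed_start] at h5
  have h6 := mul_left_cancel₀ hθ0 h5
  have h7 := (mul_eq_zero.1 h4).resolve_left hθ0
  exact ⟨by linarith, h6⟩

end IsControlBall
end ConservationLaw

/-! ### Integral curves of the characteristic field -/

namespace ConservationLaw

section GlobalFlow
variable {E : Type*} [NormedAddCommGroup E] [NormedSpace ℝ E] {X : E → E} {K : NNReal}

/-- A bounded globally Lipschitz vector field has integral curves defined for all times. -/
theorem exists_forall_hasDerivAt [CompleteSpace E] {L : NNReal} (hX : LipschitzWith K X)
    (hL : ∀ x, ‖X x‖ ≤ L) (u : E) :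
    ∃ y : ℝ → E, y 0 = u ∧ ∀ t, HasDerivAt y (X (y t)) t := by
  have hloc : ∀ N : ℕ, ∃ y : ℝ → E, y 0 = u ∧
      ∀ t ∈ Ioo (-(N + 1) : ℝ) (N + 1), HasDerivAt y (X (y t)) t := fun N => by
    have hN : (0 : ℝ) ∈ Icc (-(N + 1) : ℝ) (N + 1) := by
      constructor <;> linarith [N.cast_nonneg (α := ℝ)]
    have hPL : IsPicardLindelof (fun _ => X) (⟨0, hN⟩ : Icc (-(N + 1) : ℝ) (N + 1)) u
        (L * (N + 1)) 0 L K :=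
      .of_time_independent (fun x _ => hL x) hX.lipschitzOnWith (by simp)
    obtain ⟨y, hy0, hy⟩ := hPL.exists_eq_forall_mem_Icc_hasDerivWithinAt₀
    exact ⟨y, hy0, fun t ht => (hy t (Ioo_subset_Icc_self ht)).hasDerivAt
      (Icc_mem_nhds ht.1 ht.2)⟩
  choose y hy0 hy using hloc
  have hmono : ∀ N M : ℕ, N ≤ M → EqOn (y N) (y M) (Ioo (-(N + 1) : ℝ) (N + 1)) := fun N M hNM => by
    have hNM' : (N : ℝ) ≤ M := by exact_mod_cast hNM
    refine ODE_solution_unique_of_mem_Ioo (v := fun _ => X) (s := fun _ => univ) (K := K) (t₀ := 0)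
      (fun t _ => hX.lipschitzOnWith) (by constructor <;> linarith [N.cast_nonneg (α := ℝ)])
      (fun t ht => ⟨hy N t ht, trivial⟩)
      (fun t ht => ⟨hy M t ⟨by linarith [ht.1], by linarith [ht.2]⟩, trivial⟩) (by rw [hy0, hy0])
  refine ⟨fun t => y ⌈|t|⌉₊ t, hy0 _, fun t => ?_⟩
  obtain ⟨N, hN⟩ := exists_nat_gt |t|
  have heq : ∀ τ : ℝ, |τ| < N → y ⌈|τ|⌉₊ τ = y N τ := fun τ hτ => by
    have h1 := Nat.le_ceil |τ|
    have h2 : |τ| < ⌈|τ|⌉₊ + 1 := by linarith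
    exact hmono _ N (Nat.ceil_le.2 hτ.le) (abs_lt.1 h2)
  have hN' : |t| < N + 1 := by linarith
  simp only [heq t hN]
  refine (hy N t (abs_lt.1 hN')).congr_of_eventuallyEq ?_
  filter_upwards [(continuous_abs.tendsto t).eventually_lt_const hN] with τ hτ
  exact heq τ hτ

/-- Uniqueness of integral curves issued from an end point of an interval, when the equation is only
known in the interior. -/
theorem eqOn_uIcc_of_hasDerivAt (hX : LipschitzWith K X) {y z : ℝ → E} {s : ℝ}
    (hy : ∀ t, HasDerivAt y (X (y t)) t) (hz : ContinuousOn z (uIcc 0 s))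
    (hz' : ∀ t, uIcc 0 s ∈ 𝓝 t → t ≠ 0 → HasDerivAt z (X (z t)) t) (h0 : z 0 = y 0) :
    EqOn z y (uIcc 0 s) := by
  have hyc : Continuous y := continuous_iff_continuousAt.2 fun t => (hy t).continuousAt
  rcases lt_trichotomy s 0 with hs | rfl | hs
  · rw [uIcc_of_ge hs.le] at hz hz' ⊢
    have hd : ∀ t ∈ Ioo s 0, HasDerivAt z (X (z t)) t := fun t ht =>
      hz' t (Icc_mem_nhds ht.1 ht.2) ht.2.ne
    refine ODE_solution_unique_of_mem_Icc_left (v := fun _ => X) (s := fun _ => univ) (K := K)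
      (fun _ _ => hX.lipschitzOnWith) hz (fun t ht => ?_) (fun _ _ => trivial) hyc.continuousOn
      (fun t _ => (hy t).hasDerivWithinAt) (fun _ _ => trivial) h0
    rcases ht.2.eq_or_lt with rfl | h
    · have hc := hz 0 (right_mem_Icc.2 hs.le)
      refine hasDerivWithinAt_Iic_of_tendsto_deriv (s := Ioo s 0)
        (fun t ht => (hd t ht).differentiableAt.differentiableWithinAt)
        (hc.mono Ioo_subset_Icc_self) (Ioo_mem_nhdsLT hs) ?_
      have hcX := (hX.continuous.continuousAt.tendsto.comp (hc.mono Ioo_subset_Icc_self)).mono_left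
        (nhdsWithin_le_of_mem (Ioo_mem_nhdsLT hs))
      refine hcX.congr' ?_
      filter_upwards [Ioo_mem_nhdsLT hs] with t ht
      exact (hd t ht).deriv.symm
    · exact (hd t ⟨ht.1, h⟩).hasDerivWithinAt
  · rw [uIcc_self]
    rintro _ rfl
    exact h0
  · rw [uIcc_of_le hs.le] at hz hz' ⊢
    have hd : ∀ t ∈ Ioo 0 s, HasDerivAt z (X (z t)) t := fun t ht =>
      hz' t (Icc_mem_nhds ht.1 ht.2) ht.1.ne'
    refine ODE_solution_unique_of_mem_Icc_right (v := fun _ => X) (s := fun _ => univ) (K := K)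
      (fun _ _ => hX.lipschitzOnWith) hz (fun t ht => ?_) (fun _ _ => trivial) hyc.continuousOn
      (fun t _ => (hy t).hasDerivWithinAt) (fun _ _ => trivial) h0
    rcases ht.1.eq_or_lt with rfl | h
    · have hc := hz 0 (left_mem_Icc.2 hs.le)
      refine hasDerivWithinAt_Ici_of_tendsto_deriv (s := Ioo 0 s)
        (fun t ht => (hd t ht).differentiableAt.differentiableWithinAt)
        (hc.mono Ioo_subset_Icc_self) (Ioo_mem_nhdsGT hs) ?_
      have hcX := (hX.continuous.continuousAt.tendsto.comp (hc.mono Ioo_subset_Icc_self)).mono_left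
        (nhdsWithin_le_of_mem (Ioo_mem_nhdsGT hs))
      refine hcX.congr' ?_
      filter_upwards [Ioo_mem_nhdsGT hs] with t ht
      exact (hd t ht).deriv.symm
    · exact (hd t ⟨h, ht.2⟩).hasDerivWithinAt

end GlobalFlow

/-- The retraction of `State n` onto the cube `closedBall ubar ρ` which truncates each
coordinate. -/
def clampCube {n : ℕ} (ubar : State n) (ρ : ℝ) (x : State n) : State n :=
  fun j => max (ubar j - ρ) (min (ubar j + ρ) (x j))

theorem lipschitzWith_clampCube {n : ℕ} (ubar : State n) (ρ : ℝ) :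
    LipschitzWith 1 (clampCube ubar ρ) :=
  LipschitzWith.of_dist_le_mul fun x y => by
    rw [dist_pi_le_iff (by positivity)]
    intro j
    exact (((LipschitzWith.eval j).const_min _).const_max _).dist_le_mul x y

theorem clampCube_mem {n : ℕ} (ubar : State n) {ρ : ℝ} (hρ : 0 ≤ ρ) (x : State n) :
    clampCube ubar ρ x ∈ Metric.closedBall ubar ρ := by
  rw [Metric.mem_closedBall, dist_pi_le_iff hρ]
  intro j
  rw [Real.dist_eq, abs_le]
  have h1 := le_max_left (ubar j - ρ) (min (ubar j + ρ) (x j))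
  have h2 : max (ubar j - ρ) (min (ubar j + ρ) (x j)) ≤ ubar j + ρ :=
    max_le (by linarith) (min_le_left _ _)
  rw [clampCube]
  exact ⟨by linarith, by linarith⟩

theorem clampCube_of_mem {n : ℕ} {ubar : State n} {ρ : ℝ} {x : State n}
    (hx : x ∈ Metric.closedBall ubar ρ) : clampCube ubar ρ x = x := by
  have hρ : 0 ≤ ρ := dist_nonneg.trans hx
  ext j
  rw [Metric.mem_closedBall, dist_pi_le_iff hρ] at hx
  have h1 := hx j
  rw [Real.dist_eq, abs_le] at h1
  rw [clampCube, min_eq_right (by linarith), max_eq_right (by linarith)]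

/-- The direction field spanned by `r_i`, normalized by `ℓ_i(a)` and extended from the cube
`closedBall ubar ρ` to the whole space by truncation of the coordinates. -/
def directionField {n : ℕ} (r : Fin n → State n → State n) (i : Fin n) (ubar : State n) (ρ : ℝ)
    (a x : State n) : State n :=
  (leftForm r i a (r i (clampCube ubar ρ x)))⁻¹ • r i (clampCube ubar ρ x)

/-- The integral curve through `u` of the direction field normalized by `ℓ_i(a)`. Inside the cube it
is parameterized by `ℓ_i(a) · (x - u)`. -/
def fieldLine {n : ℕ} (r : Fin n → State n → State n) (i : Fin n) (ubar : State n) (ρ : ℝ)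
    (a u : State n) : ℝ → State n :=
  Classical.epsilon fun y => y 0 = u ∧ ∀ t, HasDerivAt y (directionField r i ubar ρ a (y t)) t

variable {n : ℕ} {f : State n → State n} {lam : Fin n → State n → ℝ}
  {r : Fin n → State n → State n} {i : Fin n}

theorem directionField_of_mem {ubar a x : State n} {ρ : ℝ} (hx : x ∈ Metric.closedBall ubar ρ) :
    directionField r i ubar ρ a x = (leftForm r i a (r i x))⁻¹ • r i x := by
  rw [directionField, clampCube_of_mem hx]

namespace IsControlBall
variable {ubar : State n} {Q ρ : ℝ} (h : IsControlBall f lam r i ubar Q ρ) {a b u u₀ : State n}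
include h

local notation "B" => Metric.closedBall ubar ρ
local notation "δ₀" => 1 / (1000 * Q ^ 5)
local notation "X" => directionField r i ubar ρ
local notation "Y" => fieldLine r i ubar ρ

theorem leftForm_eigenvector_mem (ha : a ∈ B) {x : State n} (hx : x ∈ B) :
    leftForm r i a (r i x) ∈ Icc (1 / 2 : ℝ) 2 := by
  have hQ := h.one_le
  have hc := h.center_mem
  have h1 := h.abs_leftForm_sub_le ha (r i x)
  have h2 : |leftForm r i ubar (r i x - r i ubar)| ≤ Q * δ₀ :=
    ((leftForm r i ubar).le_opNorm _).trans (mul_le_mul h.norm_leftForm_le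
      (h.eigenvector_sub_le x hx) (norm_nonneg _) (by linarith))
  rw [map_sub, h.leftForm_self ubar hc] at h2
  have h3 : ‖r i x‖ ≤ 2 * Q := by
    have := norm_add_le (r i x - r i ubar) (r i ubar)
    rw [sub_add_cancel] at this
    linarith [h.eigenvector_sub_le x hx, h.norm_eigenvector_le, h.eps_le]
  have h4 := mul_le_mul_of_nonneg_left h3 h.eps_pos.le
  have h5 : δ₀ * Q ^ 1 ≤ 1 / 1000 := one_div_mul_pow_le hQ (by norm_num)
  rw [abs_le] at h1 h2
  constructor <;> linarith [h1.1, h1.2, h2.1, h2.2]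

theorem leftForm_eigenvector_clamp_mem (ha : a ∈ B) (x : State n) :
    leftForm r i a (r i (clampCube ubar ρ x)) ∈ Icc (1 / 2 : ℝ) 2 :=
  h.leftForm_eigenvector_mem ha (clampCube_mem ubar h.pos.le x)

theorem exists_lipschitzWith_directionField (ha : a ∈ B) :
    ∃ K : NNReal, LipschitzWith K (X a) := by
  have hd : ∀ x ∈ B, ContDiffAt ℝ 1 (fun x => (leftForm r i a (r i x))⁻¹ • r i x) x :=
      fun x hx => by
    have h1 := h.contDiffAt_eigenvector x hx
    have h2 : ContDiffAt ℝ 1 (fun x => leftForm r i a (r i x)) x :=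
      (leftForm r i a).contDiff.contDiffAt.comp x h1
    exact (h2.inv (by linarith [(h.leftForm_eigenvector_mem ha hx).1])).smul h1
  obtain ⟨C, hC⟩ := (isCompact_closedBall ubar ρ).exists_bound_of_continuousOn
    (f := fderiv ℝ (fun x => (leftForm r i a (r i x))⁻¹ • r i x)) fun x hx =>
      ((hd x hx).fderiv_right (m := 0) (by norm_num)).continuousAt.continuousWithinAt
  have hlip := Convex.lipschitzOnWith_of_nnnorm_fderiv_le (𝕜 := ℝ) (C := C.toNNReal)
    (fun x hx => (hd x hx).differentiableAt (by norm_num))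
    (fun x hx => NNReal.le_toNNReal_of_coe_le (hC x hx)) (convex_closedBall ubar ρ)
  exact ⟨C.toNNReal * 1, lipschitzOnWith_univ.1 (hlip.comp
    (lipschitzWith_clampCube ubar ρ).lipschitzOnWith fun x _ => clampCube_mem ubar h.pos.le x)⟩

theorem norm_directionField_le (ha : a ∈ B) (x : State n) : ‖X a x‖ ≤ 4 * Q := by
  have h1 := (h.leftForm_eigenvector_clamp_mem ha x).1
  have hx := clampCube_mem ubar h.pos.le x
  have h3 : ‖r i (clampCube ubar ρ x)‖ ≤ 2 * Q := by
    have := norm_add_le (r i (clampCube ubar ρ x) - r i ubar) (r i ubar)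
    rw [sub_add_cancel] at this
    linarith [h.eigenvector_sub_le _ hx, h.norm_eigenvector_le, h.eps_le, h.one_le]
  rw [directionField, norm_smul, norm_inv, Real.norm_of_nonneg (by linarith)]
  have h4 : (leftForm r i a (r i (clampCube ubar ρ x)))⁻¹ ≤ 2 := by
    rw [inv_le_comm₀ (by linarith) (by norm_num)]
    linarith
  have := mul_le_mul h4 h3 (norm_nonneg _) (by norm_num)
  linarith

theorem leftForm_directionField_self (ha : a ∈ B) (x : State n) : leftForm r i a (X a x) = 1 := by
  rw [directionField, map_smul, smul_eq_mul, inv_mul_cancel₀]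
  linarith [(h.leftForm_eigenvector_clamp_mem ha x).1]

/-- Changing the normalization multiplies the field by a positive factor. -/
theorem directionField_eq_smul (hb : b ∈ B) (x : State n) :
    X a x = leftForm r i b (X a x) • X b x := by
  have h1 := (h.leftForm_eigenvector_clamp_mem hb x).1
  simp only [directionField, map_smul, smul_eq_mul, smul_smul]
  rw [mul_assoc, mul_inv_cancel₀ (by linarith), mul_one]

theorem leftForm_directionField_pos (ha : a ∈ B) (hb : b ∈ B) (x : State n) :
    0 < leftForm r i b (X a x) := by
  rw [directionField, map_smul, smul_eq_mul]
  exact mul_pos (inv_pos.2 (by linarith [(h.leftForm_eigenvector_clamp_mem ha x).1]))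
    (by linarith [(h.leftForm_eigenvector_clamp_mem hb x).1])

theorem fieldLine_spec (ha : a ∈ B) (u : State n) :
    Y a u 0 = u ∧ ∀ t, HasDerivAt (Y a u) (X a (Y a u t)) t := by
  obtain ⟨K, hK⟩ := h.exists_lipschitzWith_directionField ha
  exact Classical.epsilon_spec (exists_forall_hasDerivAt hK
    (L := ⟨4 * Q, by linarith [h.one_le]⟩) (h.norm_directionField_le ha) u)

theorem fieldLine_zero (ha : a ∈ B) : Y a u 0 = u := (h.fieldLine_spec ha u).1

theorem hasDerivAt_fieldLine (ha : a ∈ B) (t : ℝ) :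
    HasDerivAt (Y a u) (X a (Y a u t)) t := (h.fieldLine_spec ha u).2 t

theorem continuous_fieldLine (ha : a ∈ B) : Continuous (Y a u) :=
  continuous_iff_continuousAt.2 fun t => (h.hasDerivAt_fieldLine ha t).continuousAt

theorem norm_fieldLine_sub_le (ha : a ∈ B) (t : ℝ) : ‖Y a u t - u‖ ≤ 4 * Q * |t| := by
  have := Convex.norm_image_sub_le_of_norm_hasDerivWithin_le (𝕜 := ℝ) (f := Y a u) (s := univ)
    (fun t _ => (h.hasDerivAt_fieldLine ha t).hasDerivWithinAt)
    (fun t _ => h.norm_directionField_le ha _) convex_univ (mem_univ 0) (mem_univ t)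
  rwa [h.fieldLine_zero ha, sub_zero] at this

theorem fieldLine_add (ha : a ∈ B) (s t : ℝ) : Y a (Y a u s) t = Y a u (s + t) := by
  obtain ⟨K, hK⟩ := h.exists_lipschitzWith_directionField ha
  have := ODE_solution_unique_univ (v := fun _ => X a) (s := fun _ => univ) (K := K) (t₀ := 0)
    (f := Y a (Y a u s)) (g := fun t => Y a u (s + t)) (fun _ => hK.lipschitzOnWith)
    (fun t => ⟨h.hasDerivAt_fieldLine ha t, trivial⟩)
    (fun t => ⟨by simpa using (h.hasDerivAt_fieldLine ha (s + t)).comp_const_add s t, trivial⟩)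
    (by rw [h.fieldLine_zero ha, add_zero])
  exact congrFun this t

theorem hasDerivAt_leftForm_fieldLine (ha : a ∈ B) (b : State n) (t : ℝ) :
    HasDerivAt (fun t => leftForm r i b (Y a u t - u)) (leftForm r i b (X a (Y a u t))) t :=
  (leftForm r i b).hasFDerivAt.comp_hasDerivAt t ((h.hasDerivAt_fieldLine ha t).sub_const u)

theorem strictMono_leftForm_fieldLine (ha : a ∈ B) (hb : b ∈ B) :
    StrictMono fun t => leftForm r i b (Y a u t - u) :=
  strictMono_of_hasDerivAt_pos (h.hasDerivAt_leftForm_fieldLine ha b)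
    fun _ => h.leftForm_directionField_pos ha hb _

/-- Integral curves for two normalizations differ by a change of parameter. -/
theorem fieldLine_eq (ha : a ∈ B) (hb : b ∈ B) (t : ℝ) :
    Y a u t = Y b u (leftForm r i b (Y a u t - u)) := by
  obtain ⟨K, hK⟩ := h.exists_lipschitzWith_directionField hb
  obtain ⟨M, hM⟩ : ∃ M : NNReal, ∀ x, ‖leftForm r i b (X a x)‖₊ ≤ M := by
    refine ⟨⟨2 * Q * (4 * Q), by nlinarith [h.one_le]⟩, fun x => ?_⟩
    exact (h.abs_leftForm_le hb _).trans (mul_le_mul_of_nonneg_left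
      (h.norm_directionField_le ha x) (by linarith [h.one_le]))
  have := ODE_solution_unique_univ (v := fun t x => leftForm r i b (X a (Y a u t)) • X b x)
    (s := fun _ => univ) (K := M * K) (t₀ := 0) (f := Y a u)
    (g := fun t => Y b u (leftForm r i b (Y a u t - u)))
    (fun t => ((lipschitzWith_smul (leftForm r i b (X a (Y a u t)))).comp hK).weaken
      (mul_le_mul_left (hM _) K) |>.lipschitzOnWith)
    (fun t => ⟨by
      rw [← h.directionField_eq_smul hb]
      exact h.hasDerivAt_fieldLine ha t, trivial⟩)
    (fun t => ⟨(h.hasDerivAt_fieldLine hb _).scomp t (h.hasDerivAt_leftForm_fieldLine ha b t),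
      trivial⟩)
    (by rw [h.fieldLine_zero ha, sub_self, map_zero, h.fieldLine_zero hb])
  exact congrFun this t

theorem leftForm_fieldLine_self (ha : a ∈ B) (t : ℝ) : leftForm r i a (Y a u t - u) = t := by
  have h1 : ∀ t, HasDerivAt (fun t => leftForm r i a (Y a u t - u) - t) 0 t := fun t => by
    have := (h.hasDerivAt_leftForm_fieldLine (u := u) ha a t).sub (hasDerivAt_id t)
    rwa [h.leftForm_directionField_self ha, sub_self] at this
  have h2 := is_const_of_deriv_eq_zero (fun t => (h1 t).differentiableAt)
    (fun t => (h1 t).deriv) t 0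
  rw [h.fieldLine_zero ha, sub_self, map_zero, sub_zero] at h2
  linarith

/-- A property of the states holds along an arc of integral curve regardless of the
normalization. -/
theorem forall_fieldLine_of_forall (ha : a ∈ B) (hb : b ∈ B) {P : State n → Prop} {t : ℝ}
    (hP : ∀ τ ∈ uIcc 0 t, P (Y a u τ)) :
    ∀ τ ∈ uIcc 0 (leftForm r i b (Y a u t - u)), P (Y b u τ) := by
  intro τ hτ
  rw [h.fieldLine_eq hb ha]
  refine hP _ ?_
  have hmono := (h.strictMono_leftForm_fieldLine (u := u) hb ha).monotone
  have := hmono.mapsTo_uIcc hτ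
  rwa [h.fieldLine_zero hb, sub_self, map_zero, ← h.fieldLine_eq ha hb,
    h.leftForm_fieldLine_self ha] at this

/-- Monotonicity of the field: `λ_i` is nondecreasing along integral curves. -/
theorem monotoneOn_fieldLine (ha : a ∈ B) {c d : ℝ} (hB : ∀ τ ∈ Icc c d, Y a u τ ∈ B) :
    MonotoneOn (fun τ => lam i (Y a u τ)) (Icc c d) := by
  have hd : ∀ τ ∈ Icc c d, HasDerivAt (fun τ => lam i (Y a u τ))
      (fderiv ℝ (lam i) (Y a u τ) (X a (Y a u τ))) τ := fun τ hτ =>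
    ((h.contDiffAt_eigenvalue _ (hB τ hτ)).differentiableAt
      (by norm_num)).hasFDerivAt.comp_hasDerivAt τ (h.hasDerivAt_fieldLine ha τ)
  refine monotoneOn_of_deriv_nonneg (convex_Icc _ _)
    (fun τ hτ => (hd τ hτ).continuousAt.continuousWithinAt) ?_ ?_ <;> rw [interior_Icc] <;>
    intro τ hτ <;> have hτ' := Ioo_subset_Icc_self hτ
  · exact (hd τ hτ').differentiableAt.differentiableWithinAt
  · rw [(hd τ hτ').deriv, directionField_of_mem (hB τ hτ'), map_smul, smul_eq_mul]
    exact mul_nonneg (inv_nonneg.2 (by linarith [(h.leftForm_eigenvector_mem ha (hB τ hτ')).1]))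
      (h.mono _ (hB τ hτ'))

end IsControlBall
end ConservationLaw

/-! ### Elementary waves and wave fans -/

namespace ConservationLaw

section Waves
variable {n : ℕ} (f : State n → State n) (lam : Fin n → State n → ℝ)
  (r : Fin n → State n → State n) (i : Fin n) (ubar : State n) (ρ : ℝ)

/-- The integral curve of the direction field (normalized by `ℓ_i(a)`) goes forward from `u` to `v`
inside the ball. By monotonicity of the field this is a rarefaction. -/
def IsForwardArc (a u v : State n) : Prop :=
  ∃ t, 0 ≤ t ∧ (∀ τ ∈ uIcc 0 t, fieldLine r i ubar ρ a u τ ∈ Metric.ball ubar ρ) ∧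
    fieldLine r i ubar ρ a u t = v

/-- The integral curve of the direction field (normalized by `ℓ_i(a)`) goes backward from `u` to `v`
inside the ball, with `λ_i` constant along it. -/
def IsBackwardContact (a u v : State n) : Prop :=
  ∃ t, t ≤ 0 ∧ (∀ τ ∈ uIcc 0 t, fieldLine r i ubar ρ a u τ ∈ Metric.ball ubar ρ ∧
    lam i (fieldLine r i ubar ρ a u τ) = lam i u) ∧ fieldLine r i ubar ρ a u t = v

/-- A shock of speed `c` on the branch `s ≤ 0` of a Hugoniot curve inside the ball. -/
def IsBackwardShock (u v : State n) (c : ℝ) : Prop :=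
  ∃ s, s ≤ 0 ∧ ∃ H σ, IsHugoniotCurve f lam r i (Metric.ball ubar ρ) u (uIcc 0 s) H σ ∧
    H s = v ∧ σ s = c

end Waves

variable {n : ℕ} {f : State n → State n} {lam : Fin n → State n → ℝ}
  {r : Fin n → State n → State n} {i : Fin n}

theorem IsRarefactionCurve.mono {U V : Set (State n)} {u : State n} {I J : Set ℝ}
    {γ : ℝ → State n} (hγ : IsRarefactionCurve r i U u I γ) (hJ : J ⊆ I)
    (hV : ∀ s ∈ J, γ s ∈ V) : IsRarefactionCurve r i V u J γ where
  start := hγ.start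
  mem := hV
  tangent := fun s hs => (hγ.tangent s (hJ hs)).imp fun _ hc => hc.mono hJ
  param := fun s hs => hγ.param s (hJ hs)

theorem IsRarefactionCurve.continuousOn {U : Set (State n)} {u : State n} {I : Set ℝ}
    {γ : ℝ → State n} (hγ : IsRarefactionCurve r i U u I γ) : ContinuousOn γ I := fun s hs =>
  (hγ.tangent s hs).choose_spec.continuousWithinAt

namespace IsControlBall
variable {ubar : State n} {Q ρ : ℝ} (h : IsControlBall f lam r i ubar Q ρ) {a b u v w u₀ : State n}
include h

local notation "B" => Metric.closedBall ubar ρ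
local notation "X" => directionField r i ubar ρ
local notation "Y" => fieldLine r i ubar ρ

theorem isRarefactionCurve_fieldLine (hu : u ∈ B) {I : Set ℝ}
    (hI : ∀ τ ∈ I, Y u u τ ∈ Metric.ball ubar ρ) :
    IsRarefactionCurve r i (Metric.ball ubar ρ) u I (Y u u) where
  start := h.fieldLine_zero hu
  mem := hI
  tangent := fun s hs => ⟨_, by
    have := h.hasDerivAt_fieldLine (u := u) hu s
    rw [directionField_of_mem (Metric.ball_subset_closedBall (hI s hs))] at this
    exact this.hasDerivWithinAt⟩
  param := fun s _ => by rw [← leftForm_apply, h.leftForm_fieldLine_self hu]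

/-- A rarefaction curve in the ball is an integral curve of the normalized field: the normalization
of its parameter determines its velocity. -/
theorem rarefactionCurve_eq {s : ℝ} {γ : ℝ → State n}
    (hγ : IsRarefactionCurve r i B u (uIcc 0 s) γ) : EqOn γ (Y u u) (uIcc 0 s) := by
  have hu : u ∈ B := hγ.start ▸ hγ.mem 0 left_mem_uIcc
  obtain ⟨K, hK⟩ := h.exists_lipschitzWith_directionField hu
  refine eqOn_uIcc_of_hasDerivAt hK (h.hasDerivAt_fieldLine hu) hγ.continuousOn
    (fun t ht _ => ?_) (by rw [hγ.start, h.fieldLine_zero hu])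
  have htm : t ∈ uIcc 0 s := mem_of_mem_nhds ht
  obtain ⟨c, hc⟩ := hγ.tangent t htm
  have hc' := hc.hasDerivAt ht
  have h1 : HasDerivAt (fun τ => leftForm r i u (γ τ - u)) (leftForm r i u (c • r i (γ t))) t :=
    (leftForm r i u).hasFDerivAt.comp_hasDerivAt t (hc'.sub_const u)
  have h2 : HasDerivAt (fun τ => leftForm r i u (γ τ - u)) 1 t := by
    refine (hasDerivAt_id t).congr_of_eventuallyEq ?_
    filter_upwards [ht] with τ hτ
    rw [leftForm_apply, hγ.param τ hτ, id]
  have h3 := h1.unique h2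
  rw [map_smul, smul_eq_mul] at h3
  rw [directionField_of_mem (hγ.mem t htm), ← eq_inv_of_mul_eq_one_left h3]
  exact hc'

/-- A rarefaction curve coincides with the integral curve as long as the latter stays in the
ball. -/
theorem rarefactionCurve_eq_of_mem_ball {U : Set (State n)} {s : ℝ} {γ : ℝ → State n}
    (hγ : IsRarefactionCurve r i U u (uIcc 0 s) γ) (hu : u ∈ B)
    (hY : ∀ τ ∈ uIcc 0 s, Y u u τ ∈ Metric.ball ubar ρ) : EqOn γ (Y u u) (uIcc 0 s) := by
  have hsub : ∀ t ∈ uIcc 0 s, (∀ τ ∈ uIcc 0 t, dist (γ τ) ubar ≤ ρ) → γ t = Y u u t :=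
    fun t ht hle => h.rarefactionCurve_eq (hγ.mono (uIcc_zero_subset ht) hle) right_mem_uIcc
  have hlt := forall_lt_of_forall_le (g := fun τ => dist (γ τ) ubar) (b := ρ)
    ((continuous_id.dist continuous_const).comp_continuousOn hγ.continuousOn)
    (by
      have := hY 0 left_mem_uIcc
      rw [h.fieldLine_zero hu] at this
      simpa only [hγ.start, Metric.mem_ball] using this)
    (fun t ht hle => by
      simp only [hsub t ht hle]
      exact hY t ht)
  exact fun τ hτ => hsub τ hτ fun t ht => (hlt t (uIcc_zero_subset hτ ht)).le

/-- A Hugoniot curve all of whose states are characteristic is an integral curve of the field. -/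
theorem hugoniotCurve_eq_fieldLine {s : ℝ} {H : ℝ → State n} {σ : ℝ → ℝ}
    (hC : IsHugoniotCurve f lam r i B u (uIcc 0 s) H σ)
    (hchar : ∀ τ ∈ uIcc 0 s, lam i (H τ) = σ τ) : EqOn H (Y u u) (uIcc 0 s) := by
  have hu : u ∈ B := hC.start ▸ hC.mem 0 left_mem_uIcc
  obtain ⟨K, hK⟩ := h.exists_lipschitzWith_directionField hu
  refine eqOn_uIcc_of_hasDerivAt hK (h.hasDerivAt_fieldLine hu) hC.continuousOn
    (fun t ht h0 => ?_) (by rw [hC.start, h.fieldLine_zero hu])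
  have htm : t ∈ uIcc 0 s := mem_of_mem_nhds ht
  obtain ⟨p, d, hp, -, hRH, hlp⟩ := h.hugoniotCurve_hasDerivAt hC ht h0
  have hlw : leftForm r i u (t⁻¹ • (H t - u)) = 1 := by
    rw [map_smul, leftForm_apply, hC.param _ htm, smul_eq_mul, inv_mul_cancel₀ h0]
  obtain ⟨-, h1, -⟩ := h.tangent_estimate (q := d * t) hu (hC.mem _ htm)
    (h.hugoniotCurve_estimate hC htm h0) hlw (by rw [hRH, mul_smul, smul_inv_smul₀ h0]) hlp
  rw [hchar t htm, sub_self, abs_zero, mul_zero, norm_le_zero_iff, sub_eq_zero] at h1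
  rw [h1, map_smul, smul_eq_mul] at hlp
  rw [directionField_of_mem (hC.mem t htm), ← eq_inv_of_mul_eq_one_left hlp, ← h1]
  exact hp

/-- Along an arc of integral curve on which `λ_i` is constant, `f - λ_i` has zero derivative, so the
Rankine-Hugoniot relation holds. -/
theorem isHugoniotCurve_fieldLine {s : ℝ}
    (hs : ∀ τ ∈ uIcc 0 s, Y u u τ ∈ Metric.ball ubar ρ ∧ lam i (Y u u τ) = lam i u) (hu : u ∈ B) :
    IsHugoniotCurve f lam r i (Metric.ball ubar ρ) u (uIcc 0 s) (Y u u) fun _ => lam i u where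
  start := h.fieldLine_zero hu
  speed_start := rfl
  continuousOn := (h.continuous_fieldLine hu).continuousOn
  continuousOn_speed := continuousOn_const
  mem := fun τ hτ => (hs τ hτ).1
  rankineHugoniot := fun τ hτ => by
    have hd : ∀ t ∈ uIcc 0 s, HasDerivWithinAt (fun t => f (Y u u t) - lam i u • Y u u t) 0
        (uIcc 0 s) t := fun t ht => by
      have hB := Metric.ball_subset_closedBall (hs t ht).1
      have h1 := h.hasDerivAt_fieldLine (u := u) hu t
      have h2 := ((h.hasFDerivAt hB).comp_hasDerivAt t h1).sub (h1.const_smul (lam i u))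
      have h3 : fderiv ℝ f (Y u u t) (X u (Y u u t)) - lam i u • X u (Y u u t) = 0 := by
        rw [directionField_of_mem hB, map_smul, h.eigen _ hB, (hs t ht).2, smul_comm, sub_self]
      rw [h3] at h2
      exact h2.hasDerivWithinAt
    have h4 := Convex.norm_image_sub_le_of_norm_hasDerivWithin_le (C := 0) hd
      (fun _ _ => norm_zero.le) (convex_uIcc 0 s) left_mem_uIcc hτ
    rw [zero_mul, norm_le_zero_iff, h.fieldLine_zero hu] at h4
    rw [smul_sub, ← sub_eq_zero, ← h4]
    abel
  param := fun τ _ => by rw [← leftForm_apply, h.leftForm_fieldLine_self hu]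

theorem isForwardArc_congr (ha : a ∈ B) (hb : b ∈ B) (hF : IsForwardArc r i ubar ρ a u v) :
    IsForwardArc r i ubar ρ b u v := by
  obtain ⟨t, ht, hU, rfl⟩ := hF
  refine ⟨leftForm r i b (Y a u t - u), ?_, h.forall_fieldLine_of_forall ha hb hU,
    (h.fieldLine_eq ha hb t).symm⟩
  have := (h.strictMono_leftForm_fieldLine (u := u) ha hb).monotone ht
  simpa [h.fieldLine_zero ha] using this

theorem isBackwardContact_congr (ha : a ∈ B) (hb : b ∈ B)
    (hF : IsBackwardContact lam r i ubar ρ a u v) : IsBackwardContact lam r i ubar ρ b u v := by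
  obtain ⟨t, ht, hU, rfl⟩ := hF
  refine ⟨leftForm r i b (Y a u t - u), ?_, h.forall_fieldLine_of_forall ha hb
    (P := fun x => x ∈ Metric.ball ubar ρ ∧ lam i x = lam i u) hU, (h.fieldLine_eq ha hb t).symm⟩
  have := (h.strictMono_leftForm_fieldLine (u := u) ha hb).monotone ht
  simpa [h.fieldLine_zero ha] using this

theorem isBackwardShock_of_contact (hu : u ∈ B) (hF : IsBackwardContact lam r i ubar ρ u u v) :
    IsBackwardShock f lam r i ubar ρ u v (lam i u) := by
  obtain ⟨t, ht, hU, rfl⟩ := hF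
  exact ⟨t, ht, _, _, h.isHugoniotCurve_fieldLine hU hu, rfl, rfl⟩

/-- Lax inequalities for backward shocks. -/
theorem speed_mem_of_isBackwardShock {c : ℝ} (hS : IsBackwardShock f lam r i ubar ρ u v c) :
    lam i v ≤ c ∧ c ≤ lam i u := by
  obtain ⟨s, hs, H, σ, hC, rfl, rfl⟩ := hS
  have hC' := hC.mono Subset.rfl fun τ hτ => Metric.ball_subset_closedBall (hC.mem τ hτ)
  refine ⟨(h.hugoniotCurve_of_nonpos hs hC' right_mem_uIcc).1, ?_⟩
  rw [← hC.speed_start]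
  exact (h.hugoniotCurve_of_nonpos hs hC' left_mem_uIcc).2

/-- Equality in one of the Lax inequalities occurs only for contact discontinuities. -/
theorem isBackwardContact_of_shock {c : ℝ} (hS : IsBackwardShock f lam r i ubar ρ u v c)
    (hor : lam i v = c ∨ c = lam i u) :
    IsBackwardContact lam r i ubar ρ u u v ∧ c = lam i u ∧ lam i v = lam i u := by
  obtain ⟨s, hs, H, σ, hC, rfl, rfl⟩ := hS
  have hC' := hC.mono Subset.rfl fun τ hτ => Metric.ball_subset_closedBall (hC.mem τ hτ)
  rw [← hC.speed_start] at hor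
  have hch := fun τ (hτ : τ ∈ uIcc 0 s) => h.hugoniotCurve_characteristic hC' hor hτ
  have heq := h.hugoniotCurve_eq_fieldLine hC' fun τ hτ => (hch τ hτ).1.trans (hch τ hτ).2.symm
  refine ⟨⟨s, hs, fun τ hτ => ?_, (heq right_mem_uIcc).symm⟩, (hch s right_mem_uIcc).2,
    (hch s right_mem_uIcc).1⟩
  rw [← heq hτ]
  exact ⟨hC.mem τ hτ, (hch τ hτ).1⟩

/-- An arc of integral curve on which `λ_i` is constant is a forward arc or a backward shock. -/
theorem isForwardArc_or_isBackwardShock {s : ℝ} (hu : u ∈ B)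
    (hs : ∀ τ ∈ uIcc 0 s, Y u u τ ∈ Metric.ball ubar ρ ∧ lam i (Y u u τ) = lam i u) :
    IsForwardArc r i ubar ρ u u (Y u u s) ∨
      IsBackwardShock f lam r i ubar ρ u (Y u u s) (lam i u) := by
  rcases le_total 0 s with h0 | h0
  · exact Or.inl ⟨s, h0, fun τ hτ => (hs τ hτ).1, rfl⟩
  · exact Or.inr (h.isBackwardShock_of_contact hu ⟨s, h0, hs, rfl⟩)

/-- Every elementary wave is a forward arc or a backward shock. The other possibilities, a backward
rarefaction and a forward admissible shock, are contact discontinuities. -/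
theorem isForwardArc_or_isBackwardShock_of_isElementaryWave {α β : ℝ}
    (hw : IsElementaryWave f lam r i (Metric.ball ubar ρ) u v α β) :
    u ∈ Metric.ball ubar ρ ∧
      ((IsForwardArc r i ubar ρ u u v ∧ α = lam i u ∧ β = lam i v) ∨
        (IsBackwardShock f lam r i ubar ρ u v β ∧ α = β)) := by
  have hcurve : ∀ {s : ℝ} {γ : ℝ → State n},
      IsRarefactionCurve r i (Metric.ball ubar ρ) u (uIcc 0 s) γ →
      u ∈ Metric.ball ubar ρ ∧ EqOn γ (Y u u) (uIcc 0 s) := fun {s γ} hγ =>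
    ⟨hγ.start ▸ hγ.mem 0 left_mem_uIcc, h.rarefactionCurve_eq
      (hγ.mono Subset.rfl fun τ hτ => Metric.ball_subset_closedBall (hγ.mem τ hτ))⟩
  have hcontact : ∀ {s : ℝ}, u ∈ Metric.ball ubar ρ →
      (∀ τ ∈ uIcc 0 s, Y u u τ ∈ Metric.ball ubar ρ ∧ lam i (Y u u τ) = lam i u) →
      (IsForwardArc r i ubar ρ u u (Y u u s) ∧ lam i u = lam i u ∧ lam i u = lam i (Y u u s)) ∨
        (IsBackwardShock f lam r i ubar ρ u (Y u u s) (lam i u) ∧ lam i u = lam i u) :=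
    fun {s} hu hs => (h.isForwardArc_or_isBackwardShock (Metric.ball_subset_closedBall hu) hs).imp
      (fun hF => ⟨hF, rfl, (hs s right_mem_uIcc).2.symm⟩) fun hS => ⟨hS, rfl⟩
  cases hw with
  | rarefaction hw =>
    obtain ⟨s, γ, hγ, rfl, hmono, rfl, rfl⟩ := hw
    obtain ⟨hu, heq⟩ := hcurve hγ
    have huB := Metric.ball_subset_closedBall hu
    refine ⟨hu, ?_⟩
    have hY : ∀ τ ∈ uIcc 0 s, Y u u τ ∈ Metric.ball ubar ρ := fun τ hτ => heq hτ ▸ hγ.mem τ hτ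
    rw [heq right_mem_uIcc]
    rcases le_total 0 s with h0 | h0
    · exact Or.inl ⟨⟨s, h0, hY, rfl⟩, rfl, rfl⟩
    · have hconst : ∀ τ ∈ uIcc 0 s, lam i (Y u u τ) = lam i u := fun τ hτ => by
        have h1 := hmono 0 left_mem_uIcc τ hτ (by simp)
        rw [heq left_mem_uIcc, heq hτ, h.fieldLine_zero huB] at h1
        rw [uIcc_of_ge h0] at hτ hY
        have h2 := h.monotoneOn_fieldLine huB
          (fun τ hτ => Metric.ball_subset_closedBall (hY τ hτ)) hτ (right_mem_Icc.2 h0) hτ.2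
        simp only [h.fieldLine_zero huB] at h2
        exact le_antisymm h2 h1
      have := hcontact hu fun τ hτ => ⟨hY τ hτ, hconst τ hτ⟩
      rwa [← hconst s right_mem_uIcc] at this ⊢
  | contact hw =>
    obtain ⟨s, γ, hγ, rfl, hconst⟩ := hw
    obtain ⟨hu, heq⟩ := hcurve hγ
    refine ⟨hu, ?_⟩
    have h0 := hconst 0 left_mem_uIcc
    rw [hγ.start] at h0
    rw [heq right_mem_uIcc, ← h0]
    refine hcontact hu fun τ hτ => ?_
    rw [← heq hτ]
    exact ⟨hγ.mem τ hτ, (hconst τ hτ).trans h0.symm⟩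
  | shock hw =>
    obtain ⟨s, H, σ, hC, rfl, rfl, hliu⟩ := hw
    have hu : u ∈ Metric.ball ubar ρ := hC.start ▸ hC.mem 0 left_mem_uIcc
    refine ⟨hu, ?_⟩
    have hC' := hC.mono Subset.rfl fun τ hτ => Metric.ball_subset_closedBall (hC.mem τ hτ)
    rcases le_total 0 s with h0 | h0
    · have hch := fun τ (hτ : τ ∈ uIcc 0 s) =>
        h.hugoniotCurve_characteristic hC' (Or.inr (h.speed_eq_of_liu h0 hC' hliu)) hτ
      have heq := h.hugoniotCurve_eq_fieldLine hC' fun τ hτ => (hch τ hτ).1.trans (hch τ hτ).2.symm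
      rw [heq right_mem_uIcc, (hch s right_mem_uIcc).2]
      refine hcontact hu fun τ hτ => ?_
      rw [← heq hτ]
      exact ⟨hC.mem τ hτ, (hch τ hτ).1⟩
    · exact Or.inr ⟨⟨s, h0, H, σ, hC, rfl, rfl⟩, rfl⟩

/-- Two forward arcs compose to a forward arc. -/
theorem isForwardArc_trans (ha : a ∈ B) (h₁ : IsForwardArc r i ubar ρ a u v)
    (h₂ : IsForwardArc r i ubar ρ a v w) : IsForwardArc r i ubar ρ a u w := by
  obtain ⟨t₁, ht₁, hU₁, rfl⟩ := h₁
  obtain ⟨t₂, ht₂, hU₂, rfl⟩ := h₂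
  refine ⟨t₁ + t₂, by linarith, fun τ hτ => ?_, (h.fieldLine_add ha t₁ t₂).symm⟩
  rw [uIcc_of_le (by linarith)] at hU₁ hU₂ hτ
  rcases le_total τ t₁ with hle | hle
  · exact hU₁ τ ⟨hτ.1, hle⟩
  · have := hU₂ (τ - t₁) ⟨by linarith, by linarith [hτ.2]⟩
    rwa [h.fieldLine_add ha, add_sub_cancel] at this

/-- A forward arc followed by a backward contact. -/
theorem isForwardArc_trans_contact (ha : a ∈ B) (h₁ : IsForwardArc r i ubar ρ a u v)
    (h₂ : IsBackwardContact lam r i ubar ρ a v w) :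
    IsForwardArc r i ubar ρ a u w ∨ IsBackwardContact lam r i ubar ρ a u w ∧ lam i v = lam i u := by
  obtain ⟨t₁, ht₁, hU₁, rfl⟩ := h₁
  obtain ⟨t₂, ht₂, hU₂, rfl⟩ := h₂
  rw [uIcc_of_le ht₁] at hU₁
  rw [uIcc_of_ge ht₂] at hU₂
  rcases le_total 0 (t₁ + t₂) with h0 | h0
  · refine Or.inl ⟨t₁ + t₂, h0, fun τ hτ => ?_, (h.fieldLine_add ha t₁ t₂).symm⟩
    rw [uIcc_of_le h0] at hτ
    exact hU₁ τ ⟨hτ.1, by linarith [hτ.2]⟩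
  · have key : ∀ τ ∈ Icc (t₁ + t₂) 0, fieldLine r i ubar ρ a u τ ∈ Metric.ball ubar ρ ∧
        lam i (fieldLine r i ubar ρ a u τ) = lam i (fieldLine r i ubar ρ a u t₁) := fun τ hτ => by
      have := hU₂ (τ - t₁) ⟨by linarith [hτ.1], by linarith [hτ.2]⟩
      rwa [h.fieldLine_add ha, add_sub_cancel] at this
    have hv := (key 0 ⟨h0, le_rfl⟩).2
    rw [h.fieldLine_zero ha] at hv
    refine Or.inr ⟨⟨t₁ + t₂, h0, fun τ hτ => ?_, (h.fieldLine_add ha t₁ t₂).symm⟩, hv.symm⟩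
    rw [uIcc_of_ge h0] at hτ
    rw [hv]
    exact key τ hτ

/-- A backward contact followed by a forward arc. -/
theorem isBackwardContact_trans_forward (ha : a ∈ B) (h₁ : IsBackwardContact lam r i ubar ρ a u v)
    (h₂ : IsForwardArc r i ubar ρ a v w) :
    IsForwardArc r i ubar ρ a u w ∨ IsBackwardContact lam r i ubar ρ a u w ∧ lam i w = lam i u := by
  obtain ⟨t₁, ht₁, hU₁, rfl⟩ := h₁
  obtain ⟨t₂, ht₂, hU₂, rfl⟩ := h₂
  rw [uIcc_of_ge ht₁] at hU₁
  rw [uIcc_of_le ht₂] at hU₂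
  rcases le_total 0 (t₁ + t₂) with h0 | h0
  · refine Or.inl ⟨t₁ + t₂, h0, fun τ hτ => ?_, (h.fieldLine_add ha t₁ t₂).symm⟩
    rw [uIcc_of_le h0] at hτ
    have := hU₂ (τ - t₁) ⟨by linarith [hτ.1], by linarith [hτ.2]⟩
    rwa [h.fieldLine_add ha, add_sub_cancel] at this
  · refine Or.inr ⟨⟨t₁ + t₂, h0, fun τ hτ => ?_, (h.fieldLine_add ha t₁ t₂).symm⟩, ?_⟩
    · rw [uIcc_of_ge h0] at hτ
      exact hU₁ τ ⟨by linarith [hτ.1], hτ.2⟩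
    · rw [h.fieldLine_add ha]
      exact (hU₁ _ ⟨by linarith, h0⟩).2

/-- Two backward contacts compose to a backward contact. -/
theorem isBackwardContact_trans (ha : a ∈ B) (h₁ : IsBackwardContact lam r i ubar ρ a u v)
    (h₂ : IsBackwardContact lam r i ubar ρ a v w) : IsBackwardContact lam r i ubar ρ a u w := by
  obtain ⟨t₁, ht₁, hU₁, rfl⟩ := h₁
  obtain ⟨t₂, ht₂, hU₂, rfl⟩ := h₂
  refine ⟨t₁ + t₂, by linarith, fun τ hτ => ?_, (h.fieldLine_add ha t₁ t₂).symm⟩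
  have hv := (hU₁ t₁ right_mem_uIcc).2
  rw [uIcc_of_ge (by linarith)] at hU₁ hU₂ hτ
  rcases le_total t₁ τ with hle | hle
  · exact hU₁ τ ⟨hle, hτ.2⟩
  · have := hU₂ (τ - t₁) ⟨by linarith [hτ.1], by linarith⟩
    rwa [h.fieldLine_add ha, add_sub_cancel, hv] at this

/-- A succession of waves of nondecreasing speeds collapses to a single forward arc or a single
backward shock: by the Lax inequalities a backward shock can follow or precede another wave only if
it is a contact discontinuity, and then both waves lie on one integral curve. -/
theorem isForwardArc_or_isBackwardShock_of_isWaveFan {β : ℝ} (hu : u ∈ B)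
    (hw : IsWaveFan f lam r i (Metric.ball ubar ρ) u v β) :
    (IsForwardArc r i ubar ρ u u v ∧ β = lam i v) ∨ IsBackwardShock f lam r i ubar ρ u v β := by
  induction hw with
  | single hw =>
    exact (h.isForwardArc_or_isBackwardShock_of_isElementaryWave hw).2.imp
      (fun ⟨hF, _, e⟩ => ⟨hF, e⟩) fun hS => hS.1
  | @append v w b a' b' hfan hw hle ih =>
    obtain ⟨hv, hw⟩ := h.isForwardArc_or_isBackwardShock_of_isElementaryWave hw
    have hvB := Metric.ball_subset_closedBall hv
    rcases ih with ⟨hF, rfl⟩ | hS <;> rcases hw with ⟨hF', rfl, rfl⟩ | ⟨hS', rfl⟩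
    · exact Or.inl ⟨h.isForwardArc_trans hu hF (h.isForwardArc_congr hvB hu hF'), rfl⟩
    · obtain ⟨hc, rfl, hwv⟩ := h.isBackwardContact_of_shock hS'
        (Or.inr (le_antisymm (h.speed_mem_of_isBackwardShock hS').2 hle))
      rcases h.isForwardArc_trans_contact hu hF (h.isBackwardContact_congr hvB hu hc) with
        hR | ⟨hR, e⟩
      · exact Or.inl ⟨hR, hwv.symm⟩
      · exact Or.inr (e ▸ h.isBackwardShock_of_contact hu hR)
    · obtain ⟨hc, -, -⟩ := h.isBackwardContact_of_shock hS
        (Or.inl (le_antisymm (h.speed_mem_of_isBackwardShock hS).1 hle))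
      rcases h.isBackwardContact_trans_forward hu hc (h.isForwardArc_congr hvB hu hF') with
        hR | ⟨hR, e⟩
      · exact Or.inl ⟨hR, rfl⟩
      · exact Or.inr (e ▸ h.isBackwardShock_of_contact hu hR)
    · have h1 := h.speed_mem_of_isBackwardShock hS
      have h2 := h.speed_mem_of_isBackwardShock hS'
      obtain ⟨hc, -, e⟩ := h.isBackwardContact_of_shock hS (Or.inl (by linarith))
      obtain ⟨hc', rfl, -⟩ := h.isBackwardContact_of_shock hS' (Or.inr (by linarith))
      exact Or.inr (e ▸ h.isBackwardShock_of_contact hu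
        (h.isBackwardContact_trans hu hc (h.isBackwardContact_congr hvB hu hc')))

end IsControlBall
end ConservationLaw

end

/-! ### The Lax wave curve -/

theorem proposition2p6 {n : ℕ}
    (f : ConservationLaw.State n → ConservationLaw.State n)
    (Ω : Set (ConservationLaw.State n))
    (lam : Fin n → ConservationLaw.State n → ℝ)
    (r : Fin n → ConservationLaw.State n → ConservationLaw.State n)
    (hsys : ConservationLaw.IsStrictlyHyperbolic f Ω lam r)
    (i : Fin n) (hmono : ConservationLaw.IsMonotoneField Ω lam r i)
    (ubar : ConservationLaw.State n) (hubar : ubar ∈ Ω) :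
    ∃ U : Set (ConservationLaw.State n), IsOpen U ∧ ubar ∈ U ∧ U ⊆ Ω ∧
      ∃ W ∈ 𝓝 ubar, ∃ s₀ : ℝ, 0 < s₀ ∧ ∀ u₀ ∈ W,
        (∃ R, ConservationLaw.IsRarefactionCurve r i U u₀ (Icc (-s₀) s₀) R) ∧
        (∃ S σ, ConservationLaw.IsHugoniotCurve f lam r i U u₀ (Icc (-s₀) s₀) S σ) ∧
        ∀ (R S : ℝ → ConservationLaw.State n) (σ : ℝ → ℝ),
          ConservationLaw.IsRarefactionCurve r i Ω u₀ (Icc (-s₀) s₀) R →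
          ConservationLaw.IsHugoniotCurve f lam r i Ω u₀ (Icc (-s₀) s₀) S σ →
            {u ∈ ConservationLaw.laxWaveSet f lam r i U u₀ |
                |ConservationLaw.dualCovector r i u₀ (u - u₀)| ≤ s₀} =
              ConservationLaw.gluedCurve R S '' Icc (-s₀) s₀ ∧
            (∀ s ∈ Icc 0 s₀, ConservationLaw.IsRarefactionWave lam r i U u₀ (R s)
              (lam i u₀) (lam i (R s))) ∧
            (∀ s ∈ Icc (-s₀) 0,
              ConservationLaw.IsAdmissibleShock f lam r i U u₀ (S s) (σ s)) := by
  open ConservationLaw in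
  obtain ⟨Q, ρ, h, hΩ⟩ := hsys.exists_isControlBall hmono hubar
  have hρ := h.pos
  have hQ := h.one_le
  -- curves move with speed at most `4 Q`, so those from `ball ubar (ρ / 2)` stay in `ball ubar ρ`
  have hs₀ : 0 < ρ / (16 * Q) := by positivity
  refine ⟨Metric.ball ubar ρ, Metric.isOpen_ball, Metric.mem_ball_self hρ,
    Metric.ball_subset_closedBall.trans hΩ, Metric.ball ubar (ρ / 2),
    Metric.ball_mem_nhds _ (by positivity), ρ / (16 * Q), hs₀, fun u₀ hu₀ => ?_⟩
  generalize hs : ρ / (16 * Q) = s₀ at hs₀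
  have hs₀Q : s₀ * (16 * Q) = ρ := by
    rw [← hs]
    field_simp
  have hu₀B : u₀ ∈ Metric.closedBall ubar ρ := by
    rw [Metric.mem_ball] at hu₀
    rw [Metric.mem_closedBall]
    linarith
  have hY : ∀ τ ∈ Icc (-s₀) s₀, fieldLine r i ubar ρ u₀ u₀ τ ∈ Metric.ball ubar ρ := fun τ hτ => by
    have h1 := h.norm_fieldLine_sub_le (u := u₀) hu₀B τ
    have h2 := mul_le_mul_of_nonneg_left (abs_le.2 hτ) (by positivity : 0 ≤ 4 * Q)
    have h3 := norm_add_le (fieldLine r i ubar ρ u₀ u₀ τ - u₀) (u₀ - ubar)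
    rw [sub_add_sub_cancel] at h3
    rw [mem_ball_iff_norm] at hu₀ ⊢
    linarith
  obtain ⟨S', σ', hS'⟩ := h.exists_hugoniotCurve hu₀ hs₀.le (by nlinarith)
  refine ⟨⟨_, h.isRarefactionCurve_fieldLine hu₀B hY⟩, ⟨S', σ', hS'⟩, fun R S σ hR hS => ?_⟩
  have hI : ∀ s ∈ Icc (-s₀) s₀, uIcc 0 s ⊆ Icc (-s₀) s₀ := fun s hs =>
    uIcc_subset_Icc ⟨by linarith, hs₀.le⟩ hs
  have hReq : ∀ s ∈ Icc (-s₀) s₀, R s = fieldLine r i ubar ρ u₀ u₀ s := fun s hs =>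
    h.rarefactionCurve_eq_of_mem_ball (hR.mono (hI s hs) fun τ hτ => hR.mem τ (hI s hs hτ)) hu₀B
      (fun τ hτ => hY τ (hI s hs hτ)) right_mem_uIcc
  have hSmem : ∀ s ∈ Icc (-s₀) s₀, S s ∈ Metric.ball ubar ρ := fun s hs => by
    have := (h.hugoniotCurve_eq_of_mem_ball
      (hS.mono (hI s hs) fun τ hτ => hS.mem τ (hI s hs hτ))
      (hS'.mono (hI s hs) fun τ hτ => hS'.mem τ (hI s hs hτ)) right_mem_uIcc).1
    exact this ▸ hS'.mem s hs
  have hrare : ∀ s ∈ Icc 0 s₀, IsRarefactionWave lam r i (Metric.ball ubar ρ) u₀ (R s)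
      (lam i u₀) (lam i (R s)) := fun s hs => by
    have hs' : s ∈ Icc (-s₀) s₀ := ⟨by linarith [hs.1], hs.2⟩
    refine ⟨s, R, hR.mono (hI s hs') fun τ hτ => ?_, rfl, fun τ₁ h₁ τ₂ h₂ hle => ?_, rfl, rfl⟩
    · rw [hReq τ (hI s hs' hτ)]
      exact hY τ (hI s hs' hτ)
    · rw [hReq τ₁ (hI s hs' h₁), hReq τ₂ (hI s hs' h₂)]
      rw [uIcc_of_le hs.1] at h₁ h₂
      rw [abs_of_nonneg h₁.1, abs_of_nonneg h₂.1] at hle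
      exact h.monotoneOn_fieldLine hu₀B (fun τ hτ => Metric.ball_subset_closedBall
        (hY τ ⟨by linarith [hτ.1], hτ.2.trans hs.2⟩)) h₁ h₂ hle
  have hshock : ∀ s ∈ Icc (-s₀) 0,
      IsAdmissibleShock f lam r i (Metric.ball ubar ρ) u₀ (S s) (σ s) := fun s hs => by
    have hs' : s ∈ Icc (-s₀) s₀ := ⟨hs.1, by linarith [hs.2]⟩
    have hC := hS.mono (hI s hs') fun τ hτ => hSmem τ (hI s hs' hτ)
    exact ⟨s, S, σ, hC, rfl, rfl, fun τ hτ => (h.hugoniotCurve_of_nonpos hs.2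
      (hC.mono Subset.rfl fun τ hτ => Metric.ball_subset_closedBall (hC.mem τ hτ)) hτ).2⟩
  refine ⟨Subset.antisymm ?_ ?_, hrare, hshock⟩
  · rintro u ⟨hu, hus⟩
    rcases hu with rfl | ⟨b, hfan⟩
    · exact ⟨0, ⟨by linarith, hs₀.le⟩, by rw [gluedCurve, if_pos le_rfl, hR.start]⟩
    rcases h.isForwardArc_or_isBackwardShock_of_isWaveFan hu₀B hfan with
      ⟨⟨t, ht, -, rfl⟩, -⟩ | ⟨s, hs0, H, c, hC, rfl, -⟩
    · rw [← leftForm_apply, h.leftForm_fieldLine_self hu₀B] at hus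
      have hts := abs_le.1 hus
      exact ⟨t, hts, by rw [gluedCurve, if_pos ht, hReq t hts]⟩
    · rw [hC.param s right_mem_uIcc] at hus
      have hss := abs_le.1 hus
      refine ⟨s, hss, ?_⟩
      rcases hs0.eq_or_lt with rfl | hneg
      · rw [gluedCurve, if_pos le_rfl, hR.start, hC.start]
      · rw [gluedCurve, if_neg (not_le.2 hneg)]
        exact (h.hugoniotCurve_eq_of_mem_ball
          (hS.mono (hI s hss) fun τ hτ => hS.mem τ (hI s hss hτ)) hC right_mem_uIcc).1
  · rintro _ ⟨s, hs, rfl⟩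
    rw [gluedCurve]
    split_ifs with h0
    · refine ⟨Or.inr ⟨_, .single (.rarefaction (hrare s ⟨h0, hs.2⟩))⟩, ?_⟩
      rw [hR.param s hs]
      exact abs_le.2 hs
    · refine ⟨Or.inr ⟨_, .single (.shock (hshock s ⟨hs.1, (not_le.1 h0).le⟩))⟩, ?_⟩
      rw [hS.param s hs]
      exact abs_le.2 hs
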